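/- **Lemma 3.1.** Let $\xi$ be a non-degenerate real random variable with $\mathbf E e^{\delta|\xi|}<\infty$ for some $\delta>0$ and $\mathbf E\xi=0$. Put $\psi(\lambda)=\mathbf E e^{\lambda\xi}\in(0,\infty]$, let $\lambda_+=\sup\{\lambda:\psi(\lambda)<\infty\}\in(0,\infty]$ and $\lambda_-=\inf\{\lambda:\psi(\lambda)<\infty\}\in[-\infty,0)$, and let $\Lambda(\alpha)=\sup_{\lambda\in\mathbb R}\{\lambda\alpha-\log\psi(\lambda)\}\in[0,\infty]$. Let $\mathbb V$ be the set of functions $f:\mathbb R\to\mathbb R$ with $f(t)=0$ for $t\le 0$ that have bounded variation on every $[0,T]$, and such that, for every $t$, the value $f(t)$ lies in the closed interval with end points $f(t-)$ and $f(t+)$. The completed graph $\Gamma_h$ of a function $h$ with one-sided limits is the set of all $(t,\alpha)$ with $\alpha$ in the closed interval with end points $h(t-)$ and $h(t+)$. For $f,g\in\mathbb V$ let $\rho(f,g)\in[0,\infty]$ be the Hausdorff distance, with respect to the norm $\max\{|t|,|\alpha|\}$ on $\mathbb R^2$, between $\Gamma_{\hat f}$ and $\Gamma_{\hat g}$, where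 $\hat f(t)=f(t)/(1+|t|)$. For $f\in\mathbb V$ write $f=f_a+f_{s+}-f_{s-}$ on $[0,\infty)$, where $f_a(t)=\int_0^t f'(s)\,ds$ is the absolutely continuous component and $f_{s+}$, $f_{s-}$ are the positive and negative variation functions of the singular component $f_s=f-f_a$. For $U>0$ put $$J_0^U(f)=\int_0^U\Lambda(f_a'(t))\,dt+\lambda_+f_{s+}(U)+|\lambda_-|f_{s-}(U)\in[0,\infty]\qquad(\infty\cdot 0=0),$$ which is non-decreasing in $U$, and let $J(f)=\lim_{U\to\infty}J_0^U(f)\in[0,\infty]$. Then: (I) $J$ is lower semicontinuous on $(\mathbb V,\rho)$: $\liminf_{\rho(g,f)\to0}J(g)\ge J(f)$ for every $f\in\mathbb V$. (II) There is a constant $C<\infty$, depending only on the law of $\xi$, such that for all $f\in\mathbb V$ and all $N\ge 0$ with $J(f)\le N$, $$|f(U)|\le C\sqrt U\,\max\{N,\sqrt N\}\qquad\text{for all }U\ge1;$$ in particular $|f(U)|\le C\sqrt U\,N$ for all $U\ge 1$ if $N\ge1$. (III) For every $f\in\mathbb V$ there are functions $f_n\in\mathbb V$, absolutely continuous on every $[0,T]$,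 with $\rho(f_n,f)\to0$ and $J(f_n)\to J(f)$ as $n\to\infty$ (also when $J(f)=\infty$). -/

import Mathlib

open MeasureTheory Set Filter Topology
open scoped ENNReal

noncomputable section

namespace HalfLineLDP

/-! ### The deviation function of a random variable -/

section Deviation

variable {Ω : Type*} [MeasurableSpace Ω]

/-- The Laplace transform `ψ(l) = E exp(l ξ)`, with values in `[0, ∞]`. -/
def psi (P : Measure Ω) (ξ : Ω → ℝ) (l : ℝ) : ℝ≥0∞ :=
  ∫⁻ ω, ENNReal.ofReal (Real.exp (l * ξ ω)) ∂P

/-- The deviation function `Λ(α) = sup_l (l α - log ψ(l))`, with values in `[-∞, ∞]`;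
it is nonnegative for a probability measure `P`, see `deviation_nonneg`. -/
def deviation (P : Measure Ω) (ξ : Ω → ℝ) (α : ℝ) : EReal :=
  ⨆ l : ℝ, (((l * α : ℝ) : EReal) - ENNReal.log (psi P ξ l))

/-- The right end point `λ₊` of the interval on which `ψ` is finite. -/
def lamPlus (P : Measure Ω) (ξ : Ω → ℝ) : EReal :=
  ⨆ (l : ℝ) (_ : psi P ξ l < ∞), (l : EReal)

/-- The left end point `λ₋` of the interval on which `ψ` is finite. -/
def lamMinus (P : Measure Ω) (ξ : Ω → ℝ) : EReal :=
  ⨅ (l : ℝ) (_ : psi P ξ l < ∞), (l : EReal)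

theorem deviation_nonneg (P : Measure Ω) [IsProbabilityMeasure P] (ξ : Ω → ℝ) (α : ℝ) :
    0 ≤ deviation P ξ α := by
  refine le_trans ?_ (le_iSup _ (0 : ℝ))
  simp [psi]

end Deviation

/-! ### The space `(𝕍, ρ)` -/

/-- The space `𝕍`: functions on `ℝ` that vanish on `(-∞, 0]`, have bounded variation on every
`[0, T]` (hence one-sided limits everywhere), and whose value at each point lies between the left
and the right limit there. -/
@[ext]
structure PathV where
  toFun : ℝ → ℝ
  eq_zero_of_nonpos : ∀ t ≤ 0, toFun t = 0
  boundedVariation : ∀ T : ℝ, 0 < T → BoundedVariationOn toFun (Icc 0 T)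
  mem_uIcc : ∀ t, toFun t ∈ uIcc (Function.leftLim toFun t) (Function.rightLim toFun t)

instance : CoeFun PathV (fun _ => ℝ → ℝ) := ⟨PathV.toFun⟩

/-- The completed graph `Γ_h`: its section at `t` is the vertical segment from
`h(t-)` to `h(t+)`. -/
def graph (h : ℝ → ℝ) : Set (ℝ × ℝ) :=
  {p | p.2 ∈ uIcc (Function.leftLim h p.1) (Function.rightLim h p.1)}

/-- Borovkov's (extended) metric: the Hausdorff distance of the completed graphs with respect to
the "square" norm `max (|t|, |α|)`, which is the norm of `ℝ × ℝ` in Mathlib. -/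
def rhoB (f g : ℝ → ℝ) : ℝ≥0∞ := Metric.hausdorffEDist (graph f) (graph g)

/-- The weighted function `f(t) / (1 + |t|)`. -/
def hat (f : ℝ → ℝ) : ℝ → ℝ := fun t => f t / (1 + |t|)

/-- The (extended) metric `ρ` of the space `𝕍`. -/
def rho (f g : PathV) : ℝ≥0∞ := rhoB (hat f) (hat g)

/-- The space `𝕍` carries the topology of `ρ`. -/
instance : PseudoEMetricSpace PathV where
  edist := rho
  edist_self _ := Metric.hausdorffEDist_self
  edist_comm _ _ := Metric.hausdorffEDist_comm
  edist_triangle _ _ _ := Metric.hausdorffEDist_triangle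

/-! ### The rate function -/

/-- The absolutely continuous component `f_a(t) = ∫₀ᵗ f'(s) ds`. -/
def acPart (f : ℝ → ℝ) : ℝ → ℝ := fun t => ∫ s in (0 : ℝ)..t, deriv f s

/-- The singular component `f_s = f - f_a`. -/
def singPart (f : ℝ → ℝ) : ℝ → ℝ := fun t => f t - acPart f t

/-- For `f` in `𝕍` the decomposition `f = f_a + f_s` is the Lebesgue decomposition: `f_a` is
absolutely continuous and `f_s` has derivative zero almost everywhere. -/
theorem lebesgue_decomposition (f : PathV) {T : ℝ} (hT : 0 < T) :
    AbsolutelyContinuousOnInterval (acPart f) 0 T ∧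
      ∀ᵐ t, t ∈ Ioo 0 T → HasDerivAt (singPart f) 0 t := by
  have hbv : BoundedVariationOn f (uIcc 0 T) := by
    rw [uIcc_of_le hT.le]
    exact f.boundedVariation T hT
  have hint := hbv.intervalIntegrable_deriv
  refine ⟨hint.absolutelyContinuousOnInterval_intervalIntegral (c := 0) (by simp), ?_⟩
  filter_upwards [hbv.locallyBoundedVariationOn.ae_differentiableWithinAt_of_mem,
    hint.ae_hasDerivAt_integral] with t h1 h2 ht
  have ht' : t ∈ uIcc 0 T := by
    rw [uIcc_of_le hT.le]
    exact Ioo_subset_Icc_self ht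
  have hd : DifferentiableAt ℝ f t := (h1 ht').differentiableAt (by
    rw [uIcc_of_le hT.le]
    exact Icc_mem_nhds ht.1 ht.2)
  have h3 := hd.hasDerivAt.sub (h2 ht' 0 (by simp))
  rw [sub_self] at h3
  exact h3

/-- The positive variation of `h` on `[0, U]`: the supremum of
`∑ i < n, (h (u (i+1)) - h (u i))⁺` over all finite monotone sequences `u` in `[0, U]`. -/
def posVar (h : ℝ → ℝ) (U : ℝ) : ℝ≥0∞ :=
  ⨆ p : ℕ × {u : ℕ → ℝ // Monotone u ∧ ∀ i, u i ∈ Icc 0 U},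
    ∑ i ∈ Finset.range p.1, ENNReal.ofReal (h (p.2.1 (i + 1)) - h (p.2.1 i))

/-- `f_{s+}(U)`: the nondecreasing part in the Jordan decomposition of `f_s`. -/
def singPlus (f : ℝ → ℝ) (U : ℝ) : ℝ≥0∞ := posVar (singPart f) U

/-- `f_{s-}(U)`: the function `-f_{s-}` is the nonincreasing part in the Jordan decomposition
of `f_s`. -/
def singMinus (f : ℝ → ℝ) (U : ℝ) : ℝ≥0∞ := posVar (fun t => -singPart f t) U

variable {Ω : Type*} [MeasurableSpace Ω]

/-- `J₀ᵁ(f) = ∫₀ᵁ Λ(f_a'(t)) dt + λ₊ f_{s+}(U) + |λ₋| f_{s-}(U)`, with `∞ * 0 = 0`. -/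
def rateOn (P : Measure Ω) (ξ : Ω → ℝ) (U : ℝ) (f : PathV) : ℝ≥0∞ :=
  (∫⁻ t in Icc 0 U, (deviation P ξ (deriv (acPart f) t)).toENNReal)
    + (lamPlus P ξ).toENNReal * singPlus f U + (lamMinus P ξ).abs * singMinus f U

/-- The rate function `J(f)`, the supremum over `U > 0` of the nondecreasing function
`U ↦ J₀ᵁ(f)`, which is its limit as `U → ∞`, see `tendsto_rateOn`. -/
def rate (P : Measure Ω) (ξ : Ω → ℝ) (f : PathV) : ℝ≥0∞ :=
  ⨆ U ∈ Ioi (0 : ℝ), rateOn P ξ U f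

theorem posVar_mono (h : ℝ → ℝ) : Monotone (posVar h) := by
  intro U V hUV
  refine iSup_le fun p => ?_
  exact le_iSup_of_le (p.1, ⟨p.2.1, p.2.2.1, fun i =>
    ⟨(p.2.2.2 i).1, (p.2.2.2 i).2.trans hUV⟩⟩) le_rfl

theorem rateOn_mono (P : Measure Ω) (ξ : Ω → ℝ) (f : PathV) :
    Monotone (fun U => rateOn P ξ U f) := by
  intro U V hUV
  dsimp only [rateOn, singPlus, singMinus]
  gcongr
  · exact posVar_mono _ hUV
  · exact posVar_mono _ hUV

theorem tendsto_rateOn (P : Measure Ω) (ξ : Ω → ℝ) (f : PathV) :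
    Tendsto (fun U => rateOn P ξ U f) atTop (𝓝 (rate P ξ f)) := by
  have h : rate P ξ f = ⨆ U, rateOn P ξ U f := by
    refine le_antisymm (iSup₂_le fun U _ => le_iSup (fun U => rateOn P ξ U f) U)
      (iSup_le fun U => ?_)
    refine le_trans (rateOn_mono P ξ f (le_max_left U 1)) ?_
    exact le_iSup₂_of_le (f := fun U (_ : U ∈ Ioi (0 : ℝ)) => rateOn P ξ U f) (max U 1)
      (lt_of_lt_of_le one_pos (le_max_right U 1)) le_rfl
  rw [h]
  exact tendsto_atTop_iSup (rateOn_mono P ξ f)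

end HalfLineLDP

end

noncomputable section

namespace HalfLineLDP

/-! ### Superadditive interval functions -/

/-! Write `φ = log ψ` on the set `S` where `ψ` is finite. Everything rests on a variational formula:
the rate over `[0, U]` is the supremum, over partitions of `[0, U]` and slopes `lᵢ ∈ S`, of `∑ (lᵢ
Δᵢf - φ(lᵢ) Δᵢt)`.

No such value exceeds the rate: this is Jensen's inequality on each interval (`chordCost_le_energy`)
plus superadditivity of the rate. Conversely (`energy_le_chainSup`), Fatou's lemma along refining
meshes bounds `∫ Λ(f')` by the supremum. Applying that bound to the tilted function `m ↦ φ(m + l) -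
φ(l)`, whose partition values are shifted by a known amount, adds `l` times the singular increment
(`lintegral_conj_deriv_add_le`). Summing over partitions, with a positive or a negative `l`
according to the sign of the increment, recovers both singular variations.

(I) Nodes can be moved to continuity points of `f` at small loss, and evaluation at such points is
`ρ`-continuous at `f` (`PathV.tendsto_eval`). So the rate is locally bounded below by functionals
that are continuous at `f`.

(II) The one-interval partition gives `l f(U) ≤ N + φ(l) U`. Centering makes `φ(l) ≤ M l²` near `0`,
and `l` of order `min(√N, 1) / √U` gives the bound.

(III) Piecewise linear interpolation does not increase the rate, by Jensen, and on a fine enough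
mesh it is `ρ`-close to `f`. Semicontinuity supplies the other inequality, whether or not the rate
is finite. -/

theorem sum_le_of_superadditive {E : ℝ → ℝ → ℝ≥0∞}
    (hE : ∀ a b c, a ≤ b → b ≤ c → E a b + E b c ≤ E a c) {u : ℕ → ℝ} (hu : Monotone u) (n : ℕ) :
    ∑ i ∈ Finset.range n, E (u i) (u (i + 1)) ≤ E (u 0) (u n) := by
  induction n with
  | zero => simp
  | succ k ih =>
    rw [Finset.sum_range_succ]
    exact (add_le_add_left ih _).trans (hE _ _ _ (hu (Nat.zero_le _)) (hu (Nat.le_succ _)))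

/-! ### Positive variation over an interval -/

/-- The positive variation of `h` on `[a, b]`. -/
def incVar (h : ℝ → ℝ) (a b : ℝ) : ℝ≥0∞ :=
  ⨆ p : ℕ × {u : ℕ → ℝ // Monotone u ∧ ∀ i, u i ∈ Icc a b},
    ∑ i ∈ Finset.range p.1, ENNReal.ofReal (h (p.2.1 (i + 1)) - h (p.2.1 i))

theorem posVar_eq_incVar (h : ℝ → ℝ) (U : ℝ) : posVar h U = incVar h 0 U := rfl

theorem sum_le_incVar (h : ℝ → ℝ) {a b : ℝ} {u : ℕ → ℝ} (hu : Monotone u)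
    (hm : ∀ i, u i ∈ Icc a b) (n : ℕ) :
    ∑ i ∈ Finset.range n, ENNReal.ofReal (h (u (i + 1)) - h (u i)) ≤ incVar h a b :=
  le_iSup_of_le (⟨n, u, hu, hm⟩ : ℕ × {u : ℕ → ℝ // Monotone u ∧ ∀ i, u i ∈ Icc a b}) le_rfl

theorem ofReal_sub_le_incVar (h : ℝ → ℝ) {a b : ℝ} (hab : a ≤ b) :
    ENNReal.ofReal (h b - h a) ≤ incVar h a b := by
  have := sum_le_incVar h (a := a) (b := b) (u := fun i => if i = 0 then a else b)
    (monotone_nat_of_le_succ fun n => by by_cases hn : n = 0 <;> simp [hn, hab])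
    (fun i => by by_cases hn : i = 0 <;> simp [hn, hab]) 1
  simpa using this

/-- Two sequences are concatenated; the extra jump from the last point of the first to the start of
the second only adds a nonnegative term. -/
theorem incVar_add_le (h : ℝ → ℝ) {a b c : ℝ} (hab : a ≤ b) (hbc : b ≤ c) :
    incVar h a b + incVar h b c ≤ incVar h a c := by
  have i1 : Nonempty (ℕ × {u : ℕ → ℝ // Monotone u ∧ ∀ i, u i ∈ Icc a b}) :=
    ⟨⟨0, fun _ => a, monotone_const, fun _ => ⟨le_rfl, hab⟩⟩⟩
  have i2 : Nonempty (ℕ × {u : ℕ → ℝ // Monotone u ∧ ∀ i, u i ∈ Icc b c}) :=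
    ⟨⟨0, fun _ => b, monotone_const, fun _ => ⟨le_rfl, hbc⟩⟩⟩
  refine ENNReal.iSup_add_iSup_le ?_
  rintro ⟨n, u, hu, hum⟩ ⟨m, v, hv, hvm⟩
  let w : ℕ → ℝ := fun i => if i ≤ n then u i else v (i - (n + 1))
  have hw : Monotone w := by
    refine monotone_nat_of_le_succ fun k => ?_
    simp only [w]
    split_ifs with h1 h2 h2
    · exact hu (Nat.le_succ k)
    · exact (hum k).2.trans (hvm _).1
    · omega
    · exact hv (by omega)
  have hwm : ∀ i, w i ∈ Icc a c := by
    intro i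
    simp only [w]
    split_ifs
    · exact ⟨(hum i).1, (hum i).2.trans hbc⟩
    · exact ⟨hab.trans (hvm _).1, (hvm _).2⟩
  refine le_trans ?_ (sum_le_incVar h hw hwm (n + 1 + m))
  rw [Finset.sum_range_add, Finset.sum_range_succ]
  refine add_le_add (le_trans (le_of_eq ?_) le_self_add) (le_of_eq ?_)
  · refine Finset.sum_congr rfl fun i hi => ?_
    have hi' := Finset.mem_range.1 hi
    simp [w, hi'.le, Nat.succ_le_of_lt hi']
  · refine Finset.sum_congr rfl fun i _ => ?_
    have e1 : ¬ (n + 1 + i ≤ n) := by omega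
    have e2 : ¬ (n + 1 + i + 1 ≤ n) := by omega
    have e3 : n + 1 + i + 1 - (n + 1) = i + 1 := by omega
    simp only [w, if_neg e1, if_neg e2, e3, Nat.add_sub_cancel_left]

/-- Partitions from `a` to `b` suffice to compute the positive variation on `[a, b]`. -/
theorem exists_partition_ge {a b : ℝ} (hab : a ≤ b) {u : ℕ → ℝ} (hu : Monotone u)
    (hm : ∀ i, u i ∈ Icc a b) (c : ℝ → ℝ → ℝ≥0∞) (n : ℕ) :
    ∃ (m : ℕ) (v : ℕ → ℝ), Monotone v ∧ v 0 = a ∧ v m = b ∧ (∀ i, v i ∈ Icc a b) ∧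
      ∑ i ∈ Finset.range n, c (u i) (u (i + 1)) ≤ ∑ i ∈ Finset.range m, c (v i) (v (i + 1)) := by
  let v : ℕ → ℝ := fun i => if i = 0 then a else if i ≤ n + 1 then u (i - 1) else b
  refine ⟨n + 2, v, ?_, by simp [v], by simp [v], ?_, ?_⟩
  · refine monotone_nat_of_le_succ fun k => ?_
    rcases Nat.eq_zero_or_pos k with rfl | hk
    · simpa [v] using (hm 0).1
    · have e1 : k ≠ 0 := hk.ne'
      simp only [v, if_neg e1, if_neg (Nat.succ_ne_zero k)]
      split_ifs
      · exact hu (by omega)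
      · exact (hm _).2
      · omega
      · exact le_rfl
  · intro i
    simp only [v]
    split_ifs
    · exact ⟨le_rfl, hab⟩
    · exact hm _
    · exact ⟨hab, le_rfl⟩
  · rw [Finset.sum_range_succ, Finset.sum_range_succ']
    refine le_trans (le_of_eq ?_) (le_self_add.trans le_self_add)
    refine Finset.sum_congr rfl fun i hi => ?_
    have hi' := Finset.mem_range.1 hi
    have e : i ≤ n := hi'.le
    have e' : i + 1 ≤ n := hi'
    simp [v, e, e']

/-- Positive and negative increments differ by the telescoping total. The additive form avoids
subtraction in `ℝ≥0∞`; it later ties the two singular variations together. -/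
theorem sum_ofReal_sub_add (h : ℝ → ℝ) (u : ℕ → ℝ) (n : ℕ) :
    ∑ i ∈ Finset.range n, ENNReal.ofReal (h (u (i + 1)) - h (u i))
        + ENNReal.ofReal (-(h (u n) - h (u 0)))
      = ∑ i ∈ Finset.range n, ENNReal.ofReal (-(h (u (i + 1)) - h (u i)))
        + ENNReal.ofReal (h (u n) - h (u 0)) := by
  have hmax : ∀ x : ℝ, max x 0 = max (-x) 0 + x := by
    intro x
    rcases le_total x 0 with hx | hx <;> simp [hx]
  rw [← ENNReal.toReal_eq_toReal_iff' (by simp [ENNReal.sum_eq_top]) (by simp [ENNReal.sum_eq_top]),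
    ENNReal.toReal_add (by simp [ENNReal.sum_eq_top]) (by simp),
    ENNReal.toReal_add (by simp [ENNReal.sum_eq_top]) (by simp),
    ENNReal.toReal_sum (by simp), ENNReal.toReal_sum (by simp)]
  simp only [ENNReal.toReal_ofReal']
  have h1 : ∑ i ∈ Finset.range n, max (h (u (i + 1)) - h (u i)) 0 =
      ∑ i ∈ Finset.range n, max (-(h (u (i + 1)) - h (u i))) 0 + (h (u n) - h (u 0)) := by
    rw [← Finset.sum_range_sub (fun i => h (u i)) n, ← Finset.sum_add_distrib]
    exact Finset.sum_congr rfl fun i _ => hmax _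
  rw [h1, hmax (h (u n) - h (u 0))]
  ring

/-! ### Conjugate functions and partition values -/

/-- The deviation function of a function `φ` on a set `S`, with values in `[0, ∞]`. -/
def conj (S : Set ℝ) (φ : ℝ → ℝ) (α : ℝ) : ℝ≥0∞ := ⨆ l : S, ENNReal.ofReal (l * α - φ l)

theorem lowerSemicontinuous_conj (S : Set ℝ) (φ : ℝ → ℝ) : LowerSemicontinuous (conj S φ) := by
  refine lowerSemicontinuous_iSup fun l => Continuous.lowerSemicontinuous ?_
  exact ENNReal.continuous_ofReal.comp (by fun_prop)

theorem measurable_conj (S : Set ℝ) (φ : ℝ → ℝ) : Measurable (conj S φ) :=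
  (lowerSemicontinuous_conj S φ).measurable

/-- The cost `h Λ((f t - f s) / h)`, `h = t - s`, of the increment of `f` from `s` to `t`. -/
def chordCost (S : Set ℝ) (φ f : ℝ → ℝ) (s t : ℝ) : ℝ≥0∞ :=
  ⨆ l : S, ENNReal.ofReal (l * (f t - f s) - φ l * (t - s))

theorem conj_mul_eq_chordCost (S : Set ℝ) (φ f : ℝ → ℝ) {s t : ℝ} (hst : s < t) :
    conj S φ ((f t - f s) / (t - s)) * ENNReal.ofReal (t - s) = chordCost S φ f s t := by
  have h : 0 < t - s := sub_pos.2 hst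
  rw [conj, chordCost, ENNReal.iSup_mul]
  refine iSup_congr fun l => ?_
  rw [← ENNReal.ofReal_mul' h.le]
  congr 1
  field_simp

/-- `x` is the value `∑ (lᵢ Δᵢf - φ(lᵢ) Δᵢt)` along a partition from `a` to `t` all of whose nodes
except possibly `a` belong to `D`. -/
inductive ChainVal (S : Set ℝ) (φ f : ℝ → ℝ) (D : Set ℝ) (a : ℝ) : ℝ → ℝ → Prop
  | nil : ChainVal S φ f D a a 0
  | snoc {s x t l : ℝ} : ChainVal S φ f D a s x → s < t → l ∈ S → t ∈ D →
      ChainVal S φ f D a t (x + (l * (f t - f s) - φ l * (t - s)))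

section Chain

variable {S : Set ℝ} {φ f : ℝ → ℝ} {D : Set ℝ}

theorem ChainVal.le {a t x : ℝ} (h : ChainVal S φ f D a t x) : a ≤ t := by
  induction h with
  | nil => exact le_rfl
  | snoc _ h1 _ _ ih => exact ih.trans h1.le

theorem ChainVal.trans {a b c x y : ℝ} (h : ChainVal S φ f D a b x)
    (h' : ChainVal S φ f D b c y) : ChainVal S φ f D a c (x + y) := by
  induction h' with
  | nil => simpa using h
  | snoc _ h1 h2 h3 ih =>
    rw [← add_assoc]
    exact ih.snoc h1 h2 h3

/-- The largest value of a partition of `[a, b]`. -/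
def chainSup (S : Set ℝ) (φ f : ℝ → ℝ) (a b : ℝ) : ℝ≥0∞ :=
  ⨆ x : {x : ℝ // ChainVal S φ f univ a b x}, ENNReal.ofReal x

theorem ChainVal.ofReal_le {a b x : ℝ} (h : ChainVal S φ f univ a b x) :
    ENNReal.ofReal x ≤ chainSup S φ f a b :=
  le_iSup_of_le (⟨x, h⟩ : {x : ℝ // ChainVal S φ f univ a b x}) le_rfl

theorem chainVal_single {a b l : ℝ} (hab : a ≤ b) (hl : l ∈ S) :
    ChainVal S φ f univ a b (l * (f b - f a) - φ l * (b - a)) := by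
  rcases hab.eq_or_lt with rfl | h
  · simpa using ChainVal.nil
  · simpa using ChainVal.nil.snoc h hl (mem_univ b)

theorem chainVal_zero {a b : ℝ} (hab : a ≤ b) (hS : (0 : ℝ) ∈ S) (h0 : φ 0 = 0) :
    ChainVal S φ f univ a b 0 := by
  simpa [h0] using chainVal_single (φ := φ) (f := f) hab hS

theorem chordCost_le_chainSup {a b : ℝ} (hab : a ≤ b) :
    chordCost S φ f a b ≤ chainSup S φ f a b :=
  iSup_le fun l => (chainVal_single hab l.2).ofReal_le

theorem chainSup_add_le (hS : (0 : ℝ) ∈ S) (h0 : φ 0 = 0) {a b c : ℝ} (hab : a ≤ b)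
    (hbc : b ≤ c) : chainSup S φ f a b + chainSup S φ f b c ≤ chainSup S φ f a c := by
  have i1 : Nonempty {x : ℝ // ChainVal S φ f univ a b x} := ⟨⟨0, chainVal_zero hab hS h0⟩⟩
  have i2 : Nonempty {x : ℝ // ChainVal S φ f univ b c x} := ⟨⟨0, chainVal_zero hbc hS h0⟩⟩
  refine ENNReal.iSup_add_iSup_le ?_
  rintro ⟨x, hx⟩ ⟨y, hy⟩
  -- `ENNReal.ofReal` truncates, so a negative value on one side is replaced by the zero-slope chain
  -- there before concatenating.
  rcases le_total x 0 with h1 | h1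
  · rw [ENNReal.ofReal_of_nonpos h1, zero_add]
    simpa using ((chainVal_zero hab hS h0).trans hy).ofReal_le
  rcases le_total y 0 with h2 | h2
  · rw [ENNReal.ofReal_of_nonpos h2, add_zero]
    simpa using (hx.trans (chainVal_zero hbc hS h0)).ofReal_le
  · rw [← ENNReal.ofReal_add h1 h2]
    exact (hx.trans hy).ofReal_le

theorem sum_chainSup_le (hS : (0 : ℝ) ∈ S) (h0 : φ 0 = 0) {u : ℕ → ℝ} (hu : Monotone u) (n : ℕ) :
    ∑ i ∈ Finset.range n, chainSup S φ f (u i) (u (i + 1)) ≤ chainSup S φ f (u 0) (u n) :=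
  sum_le_of_superadditive (fun _ _ _ => chainSup_add_le hS h0) hu n

/-- Tilting by a linear function shifts the values of all partitions by the same amount. -/
theorem ChainVal.tilt {a b x l : ℝ}
    (h : ChainVal {m | m + l ∈ S} (fun m => φ (m + l) - φ l) f D a b x) :
    ChainVal S φ f D a b (x + (l * (f b - f a) - φ l * (b - a))) := by
  induction h with
  | nil => simpa using ChainVal.nil
  | snoc _ h1 h2 h3 ih =>
    have := ih.snoc h1 h2 h3
    convert this using 1
    ring

end Chain

/-! ### Step slopes and the absolutely continuous part -/

theorem lintegral_Ioc_eq_sum (g : ℝ → ℝ≥0∞) {u : ℕ → ℝ} (hu : Monotone u) (n : ℕ) :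
    ∫⁻ t in Ioc (u 0) (u n), g t = ∑ i ∈ Finset.range n, ∫⁻ t in Ioc (u i) (u (i + 1)), g t := by
  induction n with
  | zero => simp
  | succ k ih =>
    rw [Finset.sum_range_succ, ← ih, ← Ioc_union_Ioc_eq_Ioc (hu (Nat.zero_le k)) (hu k.le_succ),
      lintegral_union measurableSet_Ioc]
    exact disjoint_left.2 fun t h1 h2 => absurd h1.2 (not_le.2 h2.1)

/-- The index of the interval `(uᵢ, uᵢ₊₁]` that contains `t`. -/
def stepIdx (u : ℕ → ℝ) (t : ℝ) : ℕ := sInf {i | t ≤ u (i + 1)}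

theorem stepIdx_eq {u : ℕ → ℝ} (hu : Monotone u) {i : ℕ} {t : ℝ} (ht : t ∈ Ioc (u i) (u (i + 1))) :
    stepIdx u t = i := by
  refine le_antisymm (Nat.sInf_le ht.2) ?_
  by_contra hlt
  push Not at hlt
  have hmem : t ≤ u (stepIdx u t + 1) := Nat.sInf_mem (s := {i | t ≤ u (i + 1)}) ⟨i, ht.2⟩
  exact absurd (hmem.trans (hu hlt)) (not_le.2 ht.1)

theorem exists_mem_Ioc {u : ℕ → ℝ} {n : ℕ} {t : ℝ} (ht : t ∈ Ioc (u 0) (u n)) :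
    ∃ i < n, t ∈ Ioc (u i) (u (i + 1)) := by
  induction n with
  | zero => exact absurd ht.2 (not_le.2 ht.1)
  | succ k ih =>
    by_cases h : t ≤ u k
    · obtain ⟨i, hi, h'⟩ := ih ⟨ht.1, h⟩
      exact ⟨i, hi.trans k.lt_succ_self, h'⟩
    · exact ⟨k, k.lt_succ_self, not_le.1 h, ht.2⟩

theorem measurable_stepIdx (u : ℕ → ℝ) : Measurable (stepIdx u) := by
  refine measurable_of_Iic fun k => ?_
  -- The last intersection collects the points beyond all nodes, where `sInf ∅ = 0`.
  have : stepIdx u ⁻¹' Iic k =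
      (⋃ i ∈ Finset.range (k + 1), Iic (u (i + 1))) ∪ ⋂ i, Ioi (u (i + 1)) := by
    ext t
    simp only [mem_preimage, mem_Iic, mem_union, mem_iUnion, mem_iInter, mem_Ioi, exists_prop,
      Finset.mem_range]
    constructor
    · intro h
      by_cases hne : ∃ i, t ≤ u (i + 1)
      · exact Or.inl ⟨_, Nat.lt_succ_of_le h, Nat.sInf_mem (s := {i | t ≤ u (i + 1)}) hne⟩
      · push Not at hne
        exact Or.inr hne
    · rintro (⟨i, hi, h⟩ | h)
      · exact (Nat.sInf_le (s := {i | t ≤ u (i + 1)}) h).trans (Nat.lt_succ_iff.1 hi)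
      · have : {i | t ≤ u (i + 1)} = ∅ := eq_empty_of_forall_notMem fun i hi =>
          absurd (h i) (not_lt.2 hi)
        simp [stepIdx, this]
  rw [this]
  exact (Finset.measurableSet_biUnion _ fun _ _ => measurableSet_Iic).union
    (MeasurableSet.iInter fun _ => measurableSet_Ioi)

/-- The slopes of `f` over the intervals `(uᵢ, uᵢ₊₁]`. -/
def stepSlope (f : ℝ → ℝ) (u : ℕ → ℝ) (t : ℝ) : ℝ :=
  (f (u (stepIdx u t + 1)) - f (u (stepIdx u t))) / (u (stepIdx u t + 1) - u (stepIdx u t))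

theorem measurable_stepSlope (f : ℝ → ℝ) (u : ℕ → ℝ) : Measurable (stepSlope f u) :=
  (measurable_from_nat (f := fun i => (f (u (i + 1)) - f (u i)) / (u (i + 1) - u i))).comp
    (measurable_stepIdx u)

theorem stepSlope_eq (f : ℝ → ℝ) {u : ℕ → ℝ} (hu : Monotone u) {i : ℕ} {t : ℝ}
    (ht : t ∈ Ioc (u i) (u (i + 1))) :
    stepSlope f u t = (f (u (i + 1)) - f (u i)) / (u (i + 1) - u i) := by
  rw [stepSlope, stepIdx_eq hu ht]

theorem lintegral_conj_stepSlope (S : Set ℝ) (φ f : ℝ → ℝ) {u : ℕ → ℝ} (hu : StrictMono u)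
    (i : ℕ) : ∫⁻ t in Ioc (u i) (u (i + 1)), conj S φ (stepSlope f u t) =
      chordCost S φ f (u i) (u (i + 1)) := by
  rw [setLIntegral_congr_fun measurableSet_Ioc
    (fun t ht => by rw [stepSlope_eq f hu.monotone ht]), setLIntegral_const, Real.volume_Ioc,
    conj_mul_eq_chordCost _ _ _ (hu i.lt_succ_self)]

/-- Slopes over shrinking intervals around `t` converge to the derivative at `t`. -/
theorem tendsto_slope_of_hasDerivAt {f : ℝ → ℝ} {f' t : ℝ} (hf : HasDerivAt f f' t)
    {a b : ℕ → ℝ} (ha : ∀ᶠ n in atTop, a n < t ∧ t ≤ b n)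
    (ha' : Tendsto a atTop (𝓝 t)) (hb' : Tendsto b atTop (𝓝 t)) :
    Tendsto (fun n => (f (b n) - f (a n)) / (b n - a n)) atTop (𝓝 f') := by
  rw [Metric.tendsto_nhds]
  intro ε hε
  -- The errors at the two ends are at most `ε/2` times `t - a n` and `b n - t`, which add up to the
  -- width `b n - a n`.
  have h1 := (hasDerivAt_iff_isLittleO.1 hf).def (half_pos hε)
  filter_upwards [ha, ha'.eventually h1, hb'.eventually h1] with n hn h2 h3
  have hpos : 0 < b n - a n := by linarith
  rw [Real.dist_eq, div_sub' hpos.ne', abs_div, abs_of_pos hpos, div_lt_iff₀ hpos]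
  simp only [smul_eq_mul, Real.norm_eq_abs] at h2 h3
  rw [abs_of_neg (by linarith : a n - t < 0)] at h2
  rw [abs_of_nonneg (by linarith : 0 ≤ b n - t)] at h3
  rw [abs_le] at h2 h3
  rw [abs_lt]
  constructor <;> nlinarith

/-- The integral of `Λ(f')` is at most the supremum over partitions. -/
theorem lintegral_conj_deriv_le {S : Set ℝ} {φ f : ℝ → ℝ} (hS : (0 : ℝ) ∈ S) (h0 : φ 0 = 0)
    {a b : ℝ} (hab : a < b) (hd : ∀ᵐ t, t ∈ Ioo a b → DifferentiableAt ℝ f t) :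
    ∫⁻ t in Ioc a b, conj S φ (deriv f t) ≤ chainSup S φ f a b := by
  let h : ℕ → ℝ := fun n => (b - a) / (n + 1)
  have hpos : ∀ n, 0 < h n := fun n => div_pos (sub_pos.2 hab) (by positivity)
  have hlim : Tendsto h atTop (𝓝 0) := by
    have := (tendsto_one_div_add_atTop_nhds_zero_nat (𝕜 := ℝ)).const_mul (b - a)
    simpa [h, div_eq_mul_inv] using this
  let u : ℕ → ℕ → ℝ := fun n i => a + i * h n
  have hu : ∀ n, StrictMono (u n) := fun n => strictMono_nat_of_lt_succ fun i => by
    have := hpos n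
    simp only [u]; push_cast; linarith
  have hu0 : ∀ n, u n 0 = a := fun n => by simp [u]
  have hun : ∀ n, u n (n + 1) = b := fun n => by
    simp only [u, h]; push_cast; field_simp; ring
  have hle : ∀ n, ∫⁻ t in Ioc a b, conj S φ (stepSlope f (u n) t) ≤ chainSup S φ f a b := by
    intro n
    have := lintegral_Ioc_eq_sum (fun t => conj S φ (stepSlope f (u n) t)) (hu n).monotone (n + 1)
    rw [hu0, hun] at this
    rw [this]
    have h2 := sum_chainSup_le (S := S) (φ := φ) (f := f) hS h0 (hu n).monotone (n + 1)
    rw [hu0, hun] at h2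
    refine le_trans (Finset.sum_le_sum fun i _ => ?_) h2
    rw [lintegral_conj_stepSlope S φ f (hu n)]
    exact chordCost_le_chainSup ((hu n).monotone i.le_succ)
  -- At a point of differentiability the slopes of the cells containing it converge to the
  -- derivative, and `conj S φ` is lower semicontinuous; Fatou's lemma then applies.
  have hae : ∀ᵐ t ∂volume.restrict (Ioc a b),
      conj S φ (deriv f t) ≤ liminf (fun n => conj S φ (stepSlope f (u n) t)) atTop := by
    rw [ae_restrict_iff' measurableSet_Ioc]
    filter_upwards [hd, (measure_eq_zero_iff_ae_notMem.1 (Real.volume_singleton (a := b)))]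
      with t ht htb htm
    have htd := (ht ⟨htm.1, lt_of_le_of_ne htm.2 htb⟩).hasDerivAt
    have hidx : ∀ n, ∃ i, t ∈ Ioc (u n i) (u n (i + 1)) := fun n => by
      obtain ⟨i, -, hi⟩ := exists_mem_Ioc (u := u n) (n := n + 1) (t := t) (by rwa [hu0, hun])
      exact ⟨i, hi⟩
    choose i hi using hidx
    have hwidth : ∀ n, u n (i n + 1) - u n (i n) = h n := fun n => by
      simp only [u]; push_cast; ring
    have hA : Tendsto (fun n => u n (i n)) atTop (𝓝 t) := by
      refine tendsto_of_tendsto_of_tendsto_of_le_of_le (g := fun n => t - h n) (h := fun _ => t)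
        (by simpa using tendsto_const_nhds.sub hlim) tendsto_const_nhds (fun n => ?_)
        (fun n => (hi n).1.le)
      have := (hi n).2
      have := hwidth n
      simp only
      linarith
    have hB : Tendsto (fun n => u n (i n + 1)) atTop (𝓝 t) := by
      have := hA.add hlim
      rw [add_zero] at this
      refine this.congr fun n => ?_
      have := hwidth n
      linarith
    have hsl := tendsto_slope_of_hasDerivAt htd (Eventually.of_forall hi) hA hB
    have : Tendsto (fun n => stepSlope f (u n) t) atTop (𝓝 (deriv f t)) :=
      hsl.congr fun n => (stepSlope_eq f (hu n).monotone (hi n)).symm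
    refine le_of_forall_lt fun y hy => ?_
    obtain ⟨z, hyz, hz⟩ := exists_between hy
    refine hyz.trans_le (le_liminf_of_le (by isBoundedDefault) ?_)
    exact (this.eventually (lowerSemicontinuous_conj S φ _ z hz)).mono fun n hn => hn.le
  calc ∫⁻ t in Ioc a b, conj S φ (deriv f t)
      ≤ ∫⁻ t in Ioc a b, liminf (fun n => conj S φ (stepSlope f (u n) t)) atTop :=
        lintegral_mono_ae hae
    _ ≤ liminf (fun n => ∫⁻ t in Ioc a b, conj S φ (stepSlope f (u n) t)) atTop :=
        lintegral_liminf_le fun n => (measurable_conj S φ).comp (measurable_stepSlope f (u n))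
    _ ≤ chainSup S φ f a b :=
        liminf_le_of_le (by isBoundedDefault) fun y hy => by
          obtain ⟨n, hn⟩ := hy.exists
          exact hn.trans (hle n)

/-! ### Tilting and the singular increment -/

/-- With `x = l α - φ l`, tilting lowers the conjugate by exactly `x`; splitting `x` into positive
and negative parts states this without subtraction. -/
theorem conj_add_le_tilt {S : Set ℝ} {φ : ℝ → ℝ} (hS : (0 : ℝ) ∈ S) (h0 : φ 0 = 0) {l : ℝ}
    (α : ℝ) :
    conj S φ α + ENNReal.ofReal (-(l * α - φ l)) ≤
      conj {m | m + l ∈ S} (fun m => φ (m + l) - φ l) α + ENNReal.ofReal (l * α - φ l) := by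
  have : Nonempty S := ⟨⟨0, hS⟩⟩
  have key : ∀ m ∈ S, ENNReal.ofReal (m * α - φ m - (l * α - φ l)) ≤
      conj {m | m + l ∈ S} (fun m => φ (m + l) - φ l) α := fun m hm => by
    refine le_iSup_of_le (⟨m - l, by simpa using hm⟩ : {m | m + l ∈ S}) (le_of_eq ?_)
    simp only [sub_add_cancel]
    congr 1
    ring
  rw [conj, ENNReal.iSup_add]
  refine iSup_le fun ⟨m, hm⟩ => ?_
  dsimp only
  rcases le_total (l * α - φ l) 0 with hx | hx
  · rw [ENNReal.ofReal_of_nonpos hx, add_zero]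
    rcases le_total (m * α - φ m) 0 with hy | hy
    · rw [ENNReal.ofReal_of_nonpos hy, zero_add]
      refine le_trans (le_of_eq ?_) (key 0 hS)
      simp [h0]
    · rw [← ENNReal.ofReal_add hy (by linarith)]
      exact key m hm
  · rw [ENNReal.ofReal_of_nonpos (by linarith : -(l * α - φ l) ≤ 0), add_zero]
    refine le_trans ?_ (add_le_add_left (key m hm) _)
    refine le_trans (ENNReal.ofReal_le_ofReal (le_of_eq ?_)) ENNReal.ofReal_add_le
    ring

/-- Integrating the tilted deviation function accounts for the singular increment. -/
theorem lintegral_conj_deriv_add_le {S : Set ℝ} {φ f : ℝ → ℝ} (hS : (0 : ℝ) ∈ S) (h0 : φ 0 = 0)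
    {a b : ℝ} (hab : a < b) (hd : ∀ᵐ t, t ∈ Ioo a b → DifferentiableAt ℝ f t)
    (hi : IntervalIntegrable (deriv f) volume a b) {l : ℝ} (hl : l ∈ S) :
    (∫⁻ t in Ioc a b, conj S φ (deriv f t)) +
      ENNReal.ofReal (l * (f b - f a - ∫ t in a..b, deriv f t)) ≤ chainSup S φ f a b := by
  set S' : Set ℝ := {m | m + l ∈ S}
  set φ' : ℝ → ℝ := fun m => φ (m + l) - φ l
  have hS' : (0 : ℝ) ∈ S' := by simpa [S'] using hl
  have h0' : φ' 0 = 0 := by simp [φ']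
  have hI := lintegral_conj_deriv_le hS h0 hab hd
  have hT := lintegral_conj_deriv_le hS' h0' hab hd
  set I := ∫⁻ t in Ioc a b, conj S φ (deriv f t)
  set K := chainSup S φ f a b
  rcases eq_or_ne K ∞ with hK | hK
  · rw [hK]; exact le_top
  set X := l * (f b - f a) - φ l * (b - a) with hX
  -- Undoing the tilt adds `X` to every value, so the tilted supremum is at most `K - X`.
  have hx : ∀ x, ChainVal S' φ' f univ a b x → x ≤ K.toReal - X := fun x hx => by
    have := (ENNReal.ofReal_le_iff_le_toReal hK).1 hx.tilt.ofReal_le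
    linarith
  have hT2 : chainSup S' φ' f a b ≤ ENNReal.ofReal (K.toReal - X) :=
    iSup_le fun x => ENNReal.ofReal_le_ofReal (hx x x.2)
  have hnn : 0 ≤ K.toReal - X := hx 0 (chainVal_zero hab.le hS' h0')
  let x : ℝ → ℝ := fun t => l * deriv f t - φ l
  have hf' : IntegrableOn (deriv f) (Ioc a b) := (intervalIntegrable_iff_integrableOn_Ioc_of_le
    hab.le).1 hi
  have hxi : Integrable x (volume.restrict (Ioc a b)) := (hf'.const_mul l).sub (by simp)
  have hxint : ∫ t in Ioc a b, x t = l * (∫ t in a..b, deriv f t) - φ l * (b - a) := by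
    rw [integral_sub (hf'.const_mul l) (by simp), integral_const_mul,
      intervalIntegral.integral_of_le hab.le]
    simp [hab.le, mul_comm]
  have hpart := integral_eq_lintegral_pos_part_sub_lintegral_neg_part hxi
  have hp : ∫⁻ t in Ioc a b, ENNReal.ofReal (x t) ≠ ∞ := hxi.lintegral_lt_top.ne
  have hn : ∫⁻ t in Ioc a b, ENNReal.ofReal (-x t) ≠ ∞ := hxi.neg.lintegral_lt_top.ne
  have hmeas : Measurable x := ((measurable_deriv f).const_mul l).sub_const _
  -- The pointwise tilt inequality integrates to `I ≤ K - X + ∫ x`; the `φ l (b - a)` terms of `X`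
  -- and `∫ x` cancel, leaving the singular increment.
  have hle : I + ∫⁻ t in Ioc a b, ENNReal.ofReal (-x t) ≤
      ENNReal.ofReal (K.toReal - X) + ∫⁻ t in Ioc a b, ENNReal.ofReal (x t) := by
    refine le_trans ?_ (add_le_add_left (hT.trans hT2) _)
    have m1 : Measurable fun t => conj S φ (deriv f t) :=
      (measurable_conj S φ).comp (measurable_deriv f)
    have m2 : Measurable fun t => conj S' φ' (deriv f t) :=
      (measurable_conj S' φ').comp (measurable_deriv f)
    rw [← lintegral_add_left m1, ← lintegral_add_left m2]
    exact lintegral_mono fun t => conj_add_le_tilt hS h0 _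
  have hItop : I ≠ ∞ := ne_top_of_le_ne_top hK hI
  have hle' := ENNReal.toReal_mono (by simp [hp]) hle
  rw [ENNReal.toReal_add hItop hn, ENNReal.toReal_add (by simp) hp,
    ENNReal.toReal_ofReal hnn] at hle'
  rcases le_total (l * (f b - f a - ∫ t in a..b, deriv f t)) 0 with hY | hY
  · rwa [ENNReal.ofReal_of_nonpos hY, add_zero]
  · rw [← ENNReal.ofReal_toReal hItop, ← ENNReal.ofReal_add ENNReal.toReal_nonneg hY,
      ← ENNReal.ofReal_toReal hK]
    refine ENNReal.ofReal_le_ofReal ?_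
    have e : (l * ∫ t in a..b, deriv f t) - φ l * (b - a) =
        (∫⁻ t in Ioc a b, ENNReal.ofReal (x t)).toReal -
        (∫⁻ t in Ioc a b, ENNReal.ofReal (-x t)).toReal := hxint.symm.trans hpart
    rw [hX] at hle'
    linarith

/-! ### Regularity of elements of `𝕍` -/

namespace PathV

variable (f : PathV)

theorem bv_uIcc {T : ℝ} (hT : 0 < T) : BoundedVariationOn f (uIcc 0 T) := by
  rw [uIcc_of_le hT.le]
  exact f.boundedVariation T hT

theorem intervalIntegrable_deriv {a b : ℝ} (ha : 0 ≤ a) (hb : 0 ≤ b) :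
    IntervalIntegrable (deriv f) volume a b := by
  have hT : 0 < max a b + 1 := by positivity
  refine (f.bv_uIcc hT).intervalIntegrable_deriv.mono_set ?_
  rw [uIcc_of_le hT.le]
  exact (ordConnected_Icc).uIcc_subset ⟨ha, by linarith [le_max_left a b]⟩
    ⟨hb, by linarith [le_max_right a b]⟩

theorem ae_differentiableAt : ∀ᵐ t, 0 < t → DifferentiableAt ℝ f t := by
  have h : ∀ n : ℕ, ∀ᵐ t, t ∈ Ioo (0 : ℝ) (n + 1) → DifferentiableAt ℝ f t := fun n => by
    have hT : (0 : ℝ) < n + 1 := by positivity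
    have hbv := (f.boundedVariation _ hT).locallyBoundedVariationOn
    filter_upwards [hbv.ae_differentiableWithinAt_of_mem]
      with t h1 ht
    exact (h1 (Ioo_subset_Icc_self ht)).differentiableAt (Icc_mem_nhds ht.1 ht.2)
  filter_upwards [ae_all_iff.2 h] with t ht h0
  obtain ⟨n, hn⟩ := exists_nat_gt t
  exact ht n ⟨h0, by linarith⟩

theorem ae_deriv_acPart : ∀ᵐ t, 0 < t → deriv (acPart f) t = deriv f t := by
  have h : ∀ n : ℕ, ∀ᵐ t, t ∈ Ioo (0 : ℝ) (n + 1) → deriv (acPart f) t = deriv f t := fun n => by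
    have hT : (0 : ℝ) ≤ n + 1 := by positivity
    filter_upwards [(f.intervalIntegrable_deriv le_rfl hT).ae_hasDerivAt_integral] with t h1 ht
    refine (h1 ?_ 0 (by simp)).deriv
    rw [uIcc_of_le hT]
    exact Ioo_subset_Icc_self ht
  filter_upwards [ae_all_iff.2 h] with t ht h0
  obtain ⟨n, hn⟩ := exists_nat_gt t
  exact ht n ⟨h0, by linarith⟩

theorem singPart_sub {a b : ℝ} (ha : 0 ≤ a) (hb : 0 ≤ b) :
    singPart f b - singPart f a = f b - f a - ∫ t in a..b, deriv f t := by
  have := intervalIntegral.integral_interval_sub_left (f.intervalIntegrable_deriv le_rfl hb)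
    (f.intervalIntegrable_deriv le_rfl ha)
  simp only [singPart, acPart]
  linarith

/-- Bounded variation makes the limit exist, so `Function.leftLim` is not its default value. -/
theorem tendsto_leftLim (t : ℝ) : Tendsto f (𝓝[<] t) (𝓝 (Function.leftLim f t)) := by
  refine tendsto_leftLim_of_tendsto ?_
  rcases le_or_gt t 0 with ht | ht
  · refine ⟨0, tendsto_const_nhds.congr' ?_⟩
    filter_upwards [self_mem_nhdsWithin] with s hs
    exact (f.eq_zero_of_nonpos s (le_trans (le_of_lt hs) ht)).symm
  · obtain ⟨y, hy⟩ := (f.boundedVariation t ht).exists_tendsto_left t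
    refine ⟨y, hy.mono_left (le_of_eq ?_)⟩
    refine nhdsWithin_eq_nhdsWithin (s := Ioi 0) ht isOpen_Ioi ?_
    ext s
    simp only [mem_inter_iff, mem_Iio, mem_Ioi, mem_Icc]
    exact ⟨fun h => ⟨⟨⟨h.2.le, h.1.le⟩, h.1⟩, h.2⟩, fun h => ⟨h.1.2, h.2⟩⟩

theorem tendsto_rightLim (t : ℝ) : Tendsto f (𝓝[>] t) (𝓝 (Function.rightLim f t)) := by
  refine tendsto_rightLim_of_tendsto ?_
  rcases lt_or_ge t 0 with ht | ht
  · refine ⟨0, tendsto_const_nhds.congr' ?_⟩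
    filter_upwards [mem_nhdsWithin_of_mem_nhds (Iio_mem_nhds ht)] with s hs
    exact (f.eq_zero_of_nonpos s (le_of_lt hs)).symm
  · obtain ⟨y, hy⟩ := (f.boundedVariation (t + 1) (by linarith)).exists_tendsto_right t
    refine ⟨y, hy.mono_left (le_of_eq ?_)⟩
    refine nhdsWithin_eq_nhdsWithin (s := Iio (t + 1)) (lt_add_one t) isOpen_Iio ?_
    ext s
    simp only [mem_inter_iff, mem_Iio, mem_Ioi, mem_Icc]
    exact ⟨fun h => ⟨⟨⟨by linarith, h.2.le⟩, h.1⟩, h.2⟩, fun h => ⟨h.1.2, h.2⟩⟩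

end PathV

/-! ### The rate of a path over an interval -/

/-- The rate of `f` over `[a, b]`. -/
def energy (S : Set ℝ) (φ f : ℝ → ℝ) (a b : ℝ) : ℝ≥0∞ :=
  (∫⁻ t in Ioc a b, conj S φ (deriv f t)) + (⨆ l : S, ENNReal.ofReal l) * incVar (singPart f) a b
    + (⨆ l : S, ENNReal.ofReal (-l)) * incVar (fun t => -singPart f t) a b

theorem lintegral_Ioc_add (g : ℝ → ℝ≥0∞) {a b c : ℝ} (hab : a ≤ b) (hbc : b ≤ c) :
    (∫⁻ t in Ioc a b, g t) + ∫⁻ t in Ioc b c, g t = ∫⁻ t in Ioc a c, g t := by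
  rw [← Ioc_union_Ioc_eq_Ioc hab hbc, lintegral_union measurableSet_Ioc]
  exact disjoint_left.2 fun t h1 h2 => absurd h1.2 (not_le.2 h2.1)

theorem energy_add_le (S : Set ℝ) (φ f : ℝ → ℝ) {a b c : ℝ} (hab : a ≤ b) (hbc : b ≤ c) :
    energy S φ f a b + energy S φ f b c ≤ energy S φ f a c := by
  unfold energy
  rw [add_add_add_comm, add_add_add_comm (∫⁻ t in Ioc a b, conj S φ (deriv f t)), ← mul_add,
    ← mul_add]
  refine add_le_add (add_le_add (lintegral_Ioc_add _ hab hbc).le ?_) ?_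
  · exact mul_le_mul_right (incVar_add_le _ hab hbc) _
  · exact mul_le_mul_right (incVar_add_le _ hab hbc) _

theorem ofReal_integral_le_lintegral {g : ℝ → ℝ} {μ : Measure ℝ} (hg : Integrable g μ) :
    ENNReal.ofReal (∫ t, g t ∂μ) ≤ ∫⁻ t, ENNReal.ofReal (g t) ∂μ := by
  rw [ENNReal.ofReal_le_iff_le_toReal hg.lintegral_lt_top.ne,
    integral_eq_lintegral_pos_part_sub_lintegral_neg_part hg]
  exact sub_le_self _ ENNReal.toReal_nonneg

/-- Jensen's inequality: the chord of a path costs no more than the path. -/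
theorem chordCost_le_energy (S : Set ℝ) (φ : ℝ → ℝ) (f : PathV) {a b : ℝ} (ha : 0 ≤ a)
    (hab : a ≤ b) : chordCost S φ f a b ≤ energy S φ f a b := by
  refine iSup_le fun ⟨l, hl⟩ => ?_
  have hf' : IntegrableOn (deriv f) (Ioc a b) := (intervalIntegrable_iff_integrableOn_Ioc_of_le
    hab).1 (f.intervalIntegrable_deriv ha (ha.trans hab))
  have hxi : Integrable (fun t => l * deriv f t - φ l) (volume.restrict (Ioc a b)) :=
    (hf'.const_mul l).sub (by simp)
  have hxint : ∫ t in Ioc a b, (l * deriv f t - φ l) =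
      l * (∫ t in a..b, deriv f t) - φ l * (b - a) := by
    rw [integral_sub (hf'.const_mul l) (by simp), integral_const_mul,
      intervalIntegral.integral_of_le hab]
    simp [hab, mul_comm]
  have hsing := f.singPart_sub ha (ha.trans hab)
  have e : l * (f b - f a) - φ l * (b - a) = (∫ t in Ioc a b, (l * deriv f t - φ l)) +
      l * (singPart f b - singPart f a) := by
    rw [hxint, hsing]; ring
  simp only [e]
  refine ENNReal.ofReal_add_le.trans ?_
  rw [energy, add_assoc]
  refine add_le_add ?_ ?_
  · refine (ofReal_integral_le_lintegral hxi).trans (lintegral_mono fun t => ?_)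
    exact le_iSup_of_le (⟨l, hl⟩ : S) le_rfl
  -- The sign of `l` decides which of the two singular variations pays for the singular increment.
  · rcases le_total 0 l with h | h
    · rw [ENNReal.ofReal_mul h]
      exact le_trans (mul_le_mul' (le_iSup_of_le (⟨l, hl⟩ : S) le_rfl)
        (ofReal_sub_le_incVar _ hab)) le_self_add
    · rw [← neg_mul_neg, ENNReal.ofReal_mul (by linarith : 0 ≤ -l), neg_sub']
      exact le_trans (mul_le_mul' (le_iSup_of_le (⟨l, hl⟩ : S) le_rfl)
        (ofReal_sub_le_incVar (fun t => -singPart f t) hab)) le_add_self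

/-- The easy half of the variational formula: Jensen on each interval, then superadditivity. -/
theorem ChainVal.ofReal_le_energy {S : Set ℝ} {φ : ℝ → ℝ} {f : PathV} {D : Set ℝ} {a t x : ℝ}
    (ha : 0 ≤ a) (h : ChainVal S φ f D a t x) : ENNReal.ofReal x ≤ energy S φ f a t := by
  induction h with
  | nil => simp
  | @snoc s x t l h1 hst hl _ ih =>
    refine ENNReal.ofReal_add_le.trans (le_trans (add_le_add ih ?_)
      (energy_add_le S φ f h1.le hst.le))
    exact le_trans (le_iSup_of_le (⟨l, hl⟩ : S) le_rfl)
      (chordCost_le_energy S φ f (ha.trans h1.le) hst.le)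

/-! ### The rate is bounded by partition values -/

/-- Only one of the two positive parts is nonzero, so a single tilt, by `l` or by `m`, suffices. -/
theorem lintegral_add_sing_le {S : Set ℝ} {φ : ℝ → ℝ} (hS : (0 : ℝ) ∈ S) (h0 : φ 0 = 0)
    (f : PathV) {a b : ℝ} (ha : 0 ≤ a) (hab : a ≤ b) {l m : ℝ} (hl : l ∈ S) (hm : m ∈ S)
    (hl0 : 0 ≤ l) (hm0 : m ≤ 0) :
    (∫⁻ t in Ioc a b, conj S φ (deriv f t)) +
      (ENNReal.ofReal l * ENNReal.ofReal (singPart f b - singPart f a) +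
      ENNReal.ofReal (-m) * ENNReal.ofReal (-(singPart f b - singPart f a))) ≤
        chainSup S φ f a b := by
  rcases hab.eq_or_lt with rfl | hab'
  · simp
  have hd : ∀ᵐ t, t ∈ Ioo a b → DifferentiableAt ℝ f t :=
    f.ae_differentiableAt.mono fun t ht h => ht (ha.trans_lt h.1)
  have key := fun k (hk : k ∈ S) => lintegral_conj_deriv_add_le hS h0 hab' hd
    (f.intervalIntegrable_deriv ha (ha.trans hab)) hk
  simp only [← f.singPart_sub ha (ha.trans hab)] at key
  rcases le_total 0 (singPart f b - singPart f a) with h | h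
  · rw [ENNReal.ofReal_of_nonpos (neg_nonpos.2 h), mul_zero, add_zero, ← ENNReal.ofReal_mul hl0]
    exact key l hl
  · rw [ENNReal.ofReal_of_nonpos h, mul_zero, zero_add, ← ENNReal.ofReal_mul (neg_nonneg.2 hm0),
      neg_mul_neg]
    exact key m hm

/-- Each partition bounds `α A + β B`, but the suprema of `A` and `B` must be taken together. Since
`A - B` depends only on the end points, `B` is eliminated, the supremum is taken over `A` alone, and
the negative variation is reinstated by `hq`. -/
theorem lintegral_add_variation_le {S : Set ℝ} {φ : ℝ → ℝ} (hS : (0 : ℝ) ∈ S) (h0 : φ 0 = 0)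
    (f : PathV) {U : ℝ} (hU : 0 ≤ U) {l m : ℝ} (hl : l ∈ S) (hm : m ∈ S)
    (hl0 : 0 ≤ l) (hm0 : m ≤ 0) :
    (∫⁻ t in Ioc 0 U, conj S φ (deriv f t)) + ENNReal.ofReal l * incVar (singPart f) 0 U +
      ENNReal.ofReal (-m) * incVar (fun t => -singPart f t) 0 U ≤ chainSup S φ f 0 U := by
  set h := singPart f
  set I := ∫⁻ t in Ioc 0 U, conj S φ (deriv f t) with hI
  set K := chainSup S φ f 0 U
  set α := ENNReal.ofReal l
  set β := ENNReal.ofReal (-m)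
  set dp := ENNReal.ofReal (h U - h 0)
  set dn := ENNReal.ofReal (-(h U - h 0))
  let A : ℕ → (ℕ → ℝ) → ℝ≥0∞ := fun n v =>
    ∑ i ∈ Finset.range n, ENNReal.ofReal (h (v (i + 1)) - h (v i))
  let B : ℕ → (ℕ → ℝ) → ℝ≥0∞ := fun n v =>
    ∑ i ∈ Finset.range n, ENNReal.ofReal (-(h (v (i + 1)) - h (v i)))
  have hAB : ∀ n v, v 0 = 0 → v n = U → A n v + dn = B n v + dp := fun n v h1 h2 => by
    have := sum_ofReal_sub_add h v n
    rwa [h1, h2] at this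
  have hK : ∀ n v, Monotone v → v 0 = 0 → v n = U → I + (α * A n v + β * B n v) ≤ K := by
    intro n v hv h1 h2
    have hs := sum_chainSup_le (S := S) (φ := φ) (f := f) hS h0 hv n
    rw [h1, h2] at hs
    refine le_trans (le_of_eq ?_) ((Finset.sum_le_sum fun i _ => lintegral_add_sing_le hS h0 f
      (h1 ▸ hv (Nat.zero_le i)) (hv i.le_succ) hl hm hl0 hm0).trans hs)
    rw [Finset.sum_add_distrib, Finset.sum_add_distrib, ← lintegral_Ioc_eq_sum _ hv, h1, h2,
      ← Finset.mul_sum, ← Finset.mul_sum]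
  have hne : Nonempty (ℕ × {u : ℕ → ℝ // Monotone u ∧ ∀ i, u i ∈ Icc 0 U}) :=
    ⟨⟨0, fun _ => 0, monotone_const, fun _ => ⟨le_rfl, hU⟩⟩⟩
  have hsup : ∀ (g : ℝ → ℝ) (x y z w : ℝ≥0∞), (∀ n v, Monotone v → v 0 = 0 → v n = U →
      (∀ i, v i ∈ Icc 0 U) →
      x + w * (∑ i ∈ Finset.range n, ENNReal.ofReal (g (v (i + 1)) - g (v i))) + z ≤ y) →
      x + w * incVar g 0 U + z ≤ y := by
    intro g x y z w hy
    rw [incVar, ENNReal.mul_iSup, ENNReal.add_iSup, ENNReal.iSup_add]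
    refine iSup_le fun ⟨n, u, hu, hum⟩ => ?_
    obtain ⟨k, v, hv, e0, eU, hvm, hle⟩ := exists_partition_ge hU hu hum
      (fun s t => ENNReal.ofReal (g t - g s)) n
    refine le_trans ?_ (hy k v hv e0 eU hvm)
    gcongr
  have hq : incVar (fun t => -h t) 0 U + dp ≤ incVar h 0 U + dn := by
    have := hsup (fun t => -h t) 0 (incVar h 0 U + dn) dp 1 fun n v hv e0 eU hvm => by
      rw [zero_add, one_mul]
      have e : ∑ i ∈ Finset.range n, ENNReal.ofReal (-h (v (i + 1)) - -h (v i)) = B n v :=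
        Finset.sum_congr rfl fun i _ => by congr 1; ring
      rw [e, ← hAB n v e0 eU]
      gcongr
      exact sum_le_incVar h hv hvm n
    simpa using this
  have hp : I + (α + β) * incVar h 0 U + β * dn ≤ K + β * dp := by
    refine hsup h I _ _ _ fun n v hv e0 eU _ => ?_
    calc I + (α + β) * A n v + β * dn = I + α * A n v + β * (A n v + dn) := by ring
      _ = I + (α * A n v + β * B n v) + β * dp := by rw [hAB n v e0 eU]; ring
      _ ≤ K + β * dp := by gcongr; exact hK n v hv e0 eU
  have hfin : β * dp ≠ ∞ := ENNReal.mul_ne_top ENNReal.ofReal_ne_top ENNReal.ofReal_ne_top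
  refine (ENNReal.add_le_add_iff_right hfin).1 ?_
  calc I + α * incVar h 0 U + β * incVar (fun t => -h t) 0 U + β * dp
      = I + α * incVar h 0 U + β * (incVar (fun t => -h t) 0 U + dp) := by ring
    _ ≤ I + α * incVar h 0 U + β * (incVar h 0 U + dn) := by gcongr
    _ = I + (α + β) * incVar h 0 U + β * dn := by ring
    _ ≤ K + β * dp := hp

/-- The rate over `[0, U]` is at most the supremum over partitions. -/
theorem energy_le_chainSup {S : Set ℝ} {φ : ℝ → ℝ} (hS : (0 : ℝ) ∈ S) (h0 : φ 0 = 0)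
    (f : PathV) {U : ℝ} (hU : 0 ≤ U) : energy S φ f 0 U ≤ chainSup S φ f 0 U := by
  have : Nonempty S := ⟨⟨0, hS⟩⟩
  rw [energy, ENNReal.iSup_mul, ENNReal.iSup_mul, ENNReal.add_iSup]
  refine iSup_le fun ⟨m, hm⟩ => ?_
  rw [ENNReal.add_iSup, ENNReal.iSup_add]
  refine iSup_le fun ⟨l, hl⟩ => ?_
  -- Truncating the slopes at `0` changes neither coefficient and stays in `S`, because `0 ∈ S`.
  have e1 : ENNReal.ofReal l = ENNReal.ofReal (max l 0) := by simp
  have e2 : ENNReal.ofReal (-m) = ENNReal.ofReal (-(min m 0)) := by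
    rw [← max_neg_neg]; simp
  dsimp only
  rw [e1, e2]
  refine lintegral_add_variation_le hS h0 f hU ?_ ?_ (le_max_right _ _) (min_le_right _ _)
  · rcases max_choice l 0 with h | h <;> rwa [h]
  · rcases min_choice m 0 with h | h <;> rwa [h]

/-! ### Lower semicontinuity -/

theorem PathV.exists_continuousAt (f : PathV) {a b : ℝ} (ha : 0 ≤ a) (hab : a < b) :
    ∃ s ∈ Ioo a b, ContinuousAt f s := by
  by_contra! hcon
  have hsub : Ioo a b ⊆ {t | ¬ (0 < t → DifferentiableAt ℝ f t)} := fun t ht h =>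
    hcon t ht (h (ha.trans_lt ht.1)).continuousAt
  have h0 : volume (Ioo a b) = 0 := measure_mono_null hsub (ae_iff.1 f.ae_differentiableAt)
  rw [Real.volume_Ioo, ENNReal.ofReal_eq_zero] at h0
  linarith

/-- As `f t` lies between the one-sided limits, one of them makes `c` times the value at least `c *
f t`; `t` is approached through continuity points on that side. -/
theorem PathV.exists_continuousAt_near (f : PathV) {t : ℝ} (ht : 0 < t) (c : ℝ) {ε : ℝ}
    (hε : 0 < ε) : ∃ s, |s - t| < ε ∧ ContinuousAt f s ∧ c * f t - ε ≤ c * f s := by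
  have hmem := f.mem_uIcc t
  have hmax : c * f t ≤ c * Function.leftLim f t ∨ c * f t ≤ c * Function.rightLim f t := by
    rw [Set.mem_uIcc] at hmem
    rcases le_total 0 c with hc | hc <;> rcases hmem with h | h
    · exact Or.inr (mul_le_mul_of_nonneg_left h.2 hc)
    · exact Or.inl (mul_le_mul_of_nonneg_left h.2 hc)
    · exact Or.inl (mul_le_mul_of_nonpos_left h.1 hc)
    · exact Or.inr (mul_le_mul_of_nonpos_left h.1 hc)
  rcases hmax with h | h
  · have h1 : ∀ᶠ s in 𝓝[<] t, c * f t - ε < c * f s :=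
      ((f.tendsto_leftLim t).const_mul c).eventually (lt_mem_nhds (by linarith))
    obtain ⟨r, hr, hr'⟩ := (mem_nhdsLT_iff_exists_Ioo_subset' ht).1 h1
    have hr2 : max (max r 0) (t - ε) < t := max_lt (max_lt hr ht) (by linarith)
    obtain ⟨s, hs, hsc⟩ := f.exists_continuousAt
      (le_max_of_le_left (le_max_right r 0) : 0 ≤ max (max r 0) (t - ε)) hr2
    have e1 : t - ε < s := lt_of_le_of_lt (le_max_right _ _) hs.1
    have e2 : r < s := lt_of_le_of_lt ((le_max_left r 0).trans (le_max_left _ _)) hs.1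
    exact ⟨s, by rw [abs_lt]; constructor <;> linarith [hs.2], hsc, le_of_lt (hr' ⟨e2, hs.2⟩)⟩
  · have h1 : ∀ᶠ s in 𝓝[>] t, c * f t - ε < c * f s :=
      ((f.tendsto_rightLim t).const_mul c).eventually (lt_mem_nhds (by linarith))
    obtain ⟨r, hr, hr'⟩ := (mem_nhdsGT_iff_exists_Ioo_subset' (lt_add_one t)).1 h1
    have hr2 : t < min r (t + ε) := lt_min hr (by linarith)
    obtain ⟨s, hs, hsc⟩ := f.exists_continuousAt ht.le hr2
    have e1 : s < t + ε := lt_of_lt_of_le hs.2 (min_le_right _ _)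
    have e2 : s < r := lt_of_lt_of_le hs.2 (min_le_left _ _)
    exact ⟨s, by rw [abs_lt]; constructor <;> linarith [hs.1], hsc, le_of_lt (hr' ⟨hs.1, e2⟩)⟩

/-- The nodes of a partition can be moved to continuity points of `f`, at an arbitrarily small
loss; `c` is the coefficient of `f t` in the next term. -/
theorem ChainVal.exists_continuousAt {S : Set ℝ} {φ : ℝ → ℝ} {f : PathV} {t x : ℝ}
    (h : ChainVal S φ f univ 0 t x) : ∀ (c : ℝ) {ε : ℝ}, 0 < ε → ∃ t' x', |t' - t| < ε ∧
      ChainVal S φ f {s | ContinuousAt f s} 0 t' x' ∧ x - c * f t - ε ≤ x' - c * f t' := by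
  induction h with
  | nil => exact fun c ε hε => ⟨0, 0, by simpa using hε, ChainVal.nil, by linarith⟩
  | @snoc s x t l h1 hst hl _ ih =>
    intro c ε hε
    -- The bound `(t - s) / 2` keeps the moved nodes in order; the last one covers a loss `η` at
    -- each of the two nodes and `2 η |φ l|` from the changed length.
    obtain ⟨η, hη, hη1, hη2, hη3⟩ : ∃ η > 0, η ≤ ε ∧ η ≤ (t - s) / 2 ∧
        η * (2 * (1 + |φ l|)) ≤ ε := by
      have hp : 0 < 2 * (1 + |φ l|) := by positivity
      refine ⟨min (min ε ((t - s) / 2)) (ε / (2 * (1 + |φ l|))), ?_, ?_, ?_, ?_⟩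
      · have := sub_pos.2 hst
        positivity
      · exact (min_le_left _ _).trans (min_le_left _ _)
      · exact (min_le_left _ _).trans (min_le_right _ _)
      · rw [← le_div_iff₀ hp]
        exact min_le_right _ _
    -- `f s` enters the new term with coefficient `-l`, and `f t` has total coefficient `l - c`.
    obtain ⟨s', x', hs', hx', hv⟩ := ih l hη
    obtain ⟨t', ht', hc', hv'⟩ := f.exists_continuousAt_near (h1.le.trans_lt hst) (l - c) hη
    have hst' : s' < t' := by
      rw [abs_lt] at hs' ht'
      linarith
    refine ⟨t', _, ht'.trans_le hη1, hx'.snoc hst' hl hc', ?_⟩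
    have hd : φ l * ((t' - s') - (t - s)) ≤ |φ l| * (2 * η) := by
      refine (le_abs_self _).trans ?_
      rw [abs_mul]
      refine mul_le_mul_of_nonneg_left ?_ (abs_nonneg _)
      rw [abs_lt] at hs' ht'
      rw [abs_le]
      constructor <;> linarith
    nlinarith

theorem PathV.mem_graph_hat_iff (f : PathV) (t α : ℝ) : (t, α) ∈ graph (hat f) ↔
    α * (1 + |t|) ∈ uIcc (Function.leftLim f t) (Function.rightLim f t) := by
  have hpos : 0 < 1 + |t| := by positivity
  have hc : Tendsto (fun s : ℝ => 1 + |s|) (𝓝 t) (𝓝 (1 + |t|)) := by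
    have : Continuous fun s : ℝ => 1 + |s| := by fun_prop
    exact this.tendsto t
  have hl : Function.leftLim (hat f) t = Function.leftLim f t / (1 + |t|) :=
    leftLim_eq_of_tendsto ((f.tendsto_leftLim t).div (hc.mono_left nhdsWithin_le_nhds) hpos.ne')
  have hr : Function.rightLim (hat f) t = Function.rightLim f t / (1 + |t|) :=
    rightLim_eq_of_tendsto ((f.tendsto_rightLim t).div (hc.mono_left nhdsWithin_le_nhds) hpos.ne')
  simp only [graph, mem_ofPred_eq, hl, hr, Set.mem_uIcc, div_le_iff₀ hpos, le_div_iff₀ hpos]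

theorem PathV.mem_graph_hat (f : PathV) (t : ℝ) : (t, hat f t) ∈ graph (hat f) := by
  rw [f.mem_graph_hat_iff, hat, div_mul_cancel₀ _ (by positivity)]
  exact f.mem_uIcc t

/-- A point of the graph of `hat g` above `s` has a neighbour on the graph of `hat f`. Its abscissa
is near `s`, so continuity of `f` at `s` pins its height, and removing the weights costs at most `η
M`. -/
theorem PathV.tendsto_eval (f : PathV) {s : ℝ} (hs : ContinuousAt f s) :
    Tendsto (fun g : PathV => g s) (𝓝 f) (𝓝 (f s)) := by
  rw [Metric.tendsto_nhds]
  intro ε hε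
  obtain ⟨δ, hδ, hδ'⟩ := Metric.continuousAt_iff.1 hs (ε / 3) (by positivity)
  have hlim : ∀ t α, |t - s| < δ → (t, α) ∈ graph (hat f) →
      |α * (1 + |t|) - f s| ≤ ε / 3 := by
    intro t α ht hα
    rw [f.mem_graph_hat_iff] at hα
    have hball : ∀ᶠ r in 𝓝 t, f r ∈ Metric.closedBall (f s) (ε / 3) := by
      filter_upwards [Metric.isOpen_ball.mem_nhds (show t ∈ Metric.ball s δ from ht)] with r hr
      exact (hδ' hr).le
    have h1 := Metric.isClosed_closedBall.mem_of_tendsto (f.tendsto_leftLim t)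
      (hball.filter_mono nhdsWithin_le_nhds)
    have h2 := Metric.isClosed_closedBall.mem_of_tendsto (f.tendsto_rightLim t)
      (hball.filter_mono nhdsWithin_le_nhds)
    exact ((convex_closedBall (f s) (ε / 3)).ordConnected.uIcc_subset h1 h2) hα
  set M := 1 + |s| + (|f s| + ε / 3) with hM
  have hMpos : 0 < M := by positivity
  obtain ⟨η, hη, hη1, hη2⟩ : ∃ η > 0, η ≤ δ ∧ η * M ≤ ε / 3 :=
    ⟨min δ (ε / 3 / M), by positivity, min_le_left _ _, by
      rw [← le_div_iff₀ hMpos]; exact min_le_right _ _⟩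
  filter_upwards [Metric.eball_mem_nhds f (ENNReal.ofReal_pos.2 hη)] with g hg
  obtain ⟨⟨t, β⟩, hmem, hdist⟩ := Metric.exists_edist_lt_of_hausdorffEDist_lt
    (g.mem_graph_hat s) (show Metric.hausdorffEDist (graph (hat g)) (graph (hat f)) < _ from hg)
  rw [edist_dist, ENNReal.ofReal_lt_ofReal_iff hη, Prod.dist_eq, max_lt_iff, Real.dist_eq,
    Real.dist_eq] at hdist
  obtain ⟨d1, d2⟩ := hdist
  simp only at d1 d2
  have h3 := hlim t β (by rw [abs_sub_comm]; linarith) hmem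
  have hβ : |β| ≤ |f s| + ε / 3 := by
    have e1 : |β * (1 + |t|)| ≤ |f s| + ε / 3 := by
      have := abs_sub_abs_le_abs_sub (β * (1 + |t|)) (f s)
      linarith
    rw [abs_mul, abs_of_pos (by positivity : 0 < 1 + |t|)] at e1
    nlinarith [abs_nonneg β, abs_nonneg t]
  have e : g s - f s = (hat g s - β) * (1 + |s|) + β * (|s| - |t|) + (β * (1 + |t|) - f s) := by
    have : g s = hat g s * (1 + |s|) := by
      rw [hat, div_mul_cancel₀ _ (by positivity)]
    rw [this]; ring
  rw [Real.dist_eq, e]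
  have t1 : |(hat g s - β) * (1 + |s|)| ≤ η * (1 + |s|) := by
    rw [abs_mul, abs_of_pos (by positivity : 0 < 1 + |s|)]
    gcongr
  have t2 : |β * (|s| - |t|)| ≤ (|f s| + ε / 3) * η := by
    rw [abs_mul]
    gcongr
    exact (abs_abs_sub_abs_le_abs_sub s t).trans d1.le
  have t3 := abs_add_three ((hat g s - β) * (1 + |s|)) (β * (|s| - |t|)) (β * (1 + |t|) - f s)
  have t4 : η * (1 + |s|) + (|f s| + ε / 3) * η = η * M := by rw [hM]; ring
  linarith

/-- With nodes and slopes fixed, the value is affine in finitely many evaluations; the initial node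
is harmless because every path vanishes at `0`. -/
theorem ChainVal.exists_tendsto {S : Set ℝ} {φ : ℝ → ℝ} {f : PathV} {t x : ℝ}
    (h : ChainVal S φ f {s | ContinuousAt f s} 0 t x) :
    Tendsto (fun g : PathV => g t) (𝓝 f) (𝓝 (f t)) ∧ ∃ X : PathV → ℝ,
      Tendsto X (𝓝 f) (𝓝 x) ∧ ∀ g : PathV, ChainVal S φ g univ 0 t (X g) := by
  induction h with
  | nil =>
    refine ⟨?_, fun _ => 0, tendsto_const_nhds, fun _ => ChainVal.nil⟩
    have : (fun g : PathV => g 0) = fun _ => f 0 := by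
      ext g
      rw [g.eq_zero_of_nonpos 0 le_rfl, f.eq_zero_of_nonpos 0 le_rfl]
    rw [this]
    exact tendsto_const_nhds
  | @snoc s x t l h1 hst hl ht ih =>
    obtain ⟨hs, X, hX, hX'⟩ := ih
    have h := f.tendsto_eval ht
    exact ⟨h, fun g => X g + (l * (g t - g s) - φ l * (t - s)),
      hX.add (((h.sub hs).const_mul l).sub_const _), fun g => (hX' g).snoc hst hl (mem_univ t)⟩

theorem lowerSemicontinuous_iSup_energy {S : Set ℝ} {φ : ℝ → ℝ} (hS : (0 : ℝ) ∈ S)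
    (h0 : φ 0 = 0) :
    LowerSemicontinuous fun f : PathV => ⨆ U ∈ Ioi (0 : ℝ), energy S φ f 0 U := by
  intro f y hy
  obtain ⟨U, hU⟩ := lt_iSup_iff.1 hy
  obtain ⟨hU0, hU⟩ := lt_iSup_iff.1 hU
  obtain ⟨⟨x, hx⟩, hxy⟩ := lt_iSup_iff.1 (hU.trans_le (energy_le_chainSup hS h0 f (le_of_lt hU0)))
  have hytop : y ≠ ∞ := hy.ne_top
  have hyx : y.toReal < x := (ENNReal.lt_ofReal_iff_toReal_lt hytop).1 hxy
  obtain ⟨t, x', -, hc, hv⟩ := hx.exists_continuousAt 0 (half_pos (sub_pos.2 hyx))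
  obtain ⟨-, X, hX, hX'⟩ := hc.exists_tendsto
  have hlt : y.toReal < x' := by linarith
  filter_upwards [hX.eventually (lt_mem_nhds hlt)] with g hg
  have e1 : y < ENNReal.ofReal (X g) := (ENNReal.lt_ofReal_iff_toReal_lt hytop).2 hg
  refine e1.trans_le (((hX' g).ofReal_le_energy le_rfl).trans ?_)
  refine le_iSup₂_of_le (max t 1) (mem_Ioi.2 (lt_max_of_lt_right one_pos)) ?_
  exact le_self_add.trans (energy_add_le S φ g hc.le (le_max_left t 1))

/-! ### The cumulant generating function -/

theorem ereal_abs_of_nonpos {x : EReal} (hx : x ≤ 0) : x.abs = (-x).toENNReal := by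
  induction x with
  | bot => simp
  | top => simp at hx
  | coe x =>
    have hx' : x ≤ 0 := EReal.coe_nonpos.1 hx
    rw [← EReal.coe_neg, EReal.real_coe_toENNReal, EReal.abs_def, abs_of_nonpos hx']

section Cumulant

variable {Ω : Type*} [MeasurableSpace Ω]

/-- The set where the Laplace transform is finite. -/
def finSet (P : Measure Ω) (ξ : Ω → ℝ) : Set ℝ := {l | psi P ξ l < ∞}

/-- The logarithm of the Laplace transform, on the set where it is finite. -/
def logPsi (P : Measure Ω) (ξ : Ω → ℝ) (l : ℝ) : ℝ := Real.log (psi P ξ l).toReal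

theorem toENNReal_lamPlus (P : Measure Ω) (ξ : Ω → ℝ) :
    (lamPlus P ξ).toENNReal = ⨆ l : finSet P ξ, ENNReal.ofReal l := by
  refine le_antisymm ?_ (iSup_le fun ⟨l, hl⟩ => ?_)
  · rw [← EReal.toENNReal_coe (x := ⨆ l : finSet P ξ, ENNReal.ofReal l)]
    refine EReal.toENNReal_le_toENNReal (iSup₂_le fun l hl => ?_)
    have h1 : ENNReal.ofReal l ≤ ⨆ l : finSet P ξ, ENNReal.ofReal l :=
      le_iSup_of_le (⟨l, hl⟩ : finSet P ξ) le_rfl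
    refine le_trans ?_ (EReal.coe_ennreal_le_coe_ennreal_iff.2 h1)
    rw [EReal.coe_ennreal_ofReal]
    exact EReal.coe_le_coe_iff.2 (le_max_left _ _)
  · rw [← EReal.real_coe_toENNReal]
    exact EReal.toENNReal_le_toENNReal
      (le_iSup₂ (f := fun (l : ℝ) (_ : psi P ξ l < ∞) => (l : EReal)) l hl)

variable (P : Measure Ω) [IsProbabilityMeasure P] {ξ : Ω → ℝ}

theorem psi_zero (ξ : Ω → ℝ) : psi P ξ 0 = 1 := by simp [psi]

theorem zero_mem_finSet (ξ : Ω → ℝ) : (0 : ℝ) ∈ finSet P ξ := by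
  simp [finSet, psi_zero]

theorem logPsi_zero (ξ : Ω → ℝ) : logPsi P ξ 0 = 0 := by
  simp [logPsi, psi_zero]

theorem psi_ne_zero (hξ : Measurable ξ) (l : ℝ) : psi P ξ l ≠ 0 := by
  rw [psi, Ne, lintegral_eq_zero_iff (by fun_prop)]
  intro h
  have : ∀ᵐ ω ∂P, False := h.mono fun ω hω => by
    simp only [Pi.zero_apply, ENNReal.ofReal_eq_zero] at hω
    exact absurd (Real.exp_pos _) (not_lt.2 hω)
  obtain ⟨ω, hω⟩ := this.exists
  exact hω

/-- Where `ψ = ∞` the term is `-∞` and drops out of the supremum; elsewhere `0 < ψ < ∞` and the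
logarithm is real. -/
theorem toENNReal_deviation (hξ : Measurable ξ) (α : ℝ) :
    (deviation P ξ α).toENNReal = conj (finSet P ξ) (logPsi P ξ) α := by
  have hlog : ∀ l ∈ finSet P ξ, ((l * α : ℝ) : EReal) - ENNReal.log (psi P ξ l) =
      ((l * α - logPsi P ξ l : ℝ) : EReal) := fun l hl => by
    rw [ENNReal.log_pos_real (psi_ne_zero P hξ l) (ne_of_lt hl)]
    rfl
  refine le_antisymm ?_ (iSup_le fun ⟨l, hl⟩ => ?_)
  · rw [← EReal.toENNReal_coe (x := conj (finSet P ξ) (logPsi P ξ) α)]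
    refine EReal.toENNReal_le_toENNReal (iSup_le fun l => ?_)
    by_cases hl : l ∈ finSet P ξ
    · rw [hlog l hl]
      have h1 : ENNReal.ofReal (l * α - logPsi P ξ l) ≤ conj (finSet P ξ) (logPsi P ξ) α :=
        le_iSup_of_le (⟨l, hl⟩ : finSet P ξ) le_rfl
      refine le_trans ?_ (EReal.coe_ennreal_le_coe_ennreal_iff.2 h1)
      rw [EReal.coe_ennreal_ofReal]
      exact EReal.coe_le_coe_iff.2 (le_max_left _ _)
    · have : psi P ξ l = ∞ := not_lt_top_iff.1 hl
      rw [this, ENNReal.log_top, EReal.sub_top]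
      exact bot_le
  · rw [← EReal.real_coe_toENNReal]
    dsimp only
    rw [← hlog l hl]
    exact EReal.toENNReal_le_toENNReal
      (le_iSup (fun l : ℝ => ((l * α : ℝ) : EReal) - ENNReal.log (psi P ξ l)) l)

theorem abs_lamMinus (ξ : Ω → ℝ) :
    (lamMinus P ξ).abs = ⨆ l : finSet P ξ, ENNReal.ofReal (-l) := by
  have hle : lamMinus P ξ ≤ 0 := iInf₂_le_of_le 0 (zero_mem_finSet P ξ) (by simp)
  rw [ereal_abs_of_nonpos hle]
  refine le_antisymm ?_ (iSup_le fun ⟨l, hl⟩ => ?_)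
  · rw [← EReal.toENNReal_coe (x := ⨆ l : finSet P ξ, ENNReal.ofReal (-l))]
    refine EReal.toENNReal_le_toENNReal ?_
    rw [EReal.neg_le]
    refine le_iInf₂ fun l hl => ?_
    rw [EReal.neg_le]
    have h1 : ENNReal.ofReal (-l) ≤ ⨆ l : finSet P ξ, ENNReal.ofReal (-l) :=
      le_iSup_of_le (⟨l, hl⟩ : finSet P ξ) le_rfl
    refine le_trans ?_ (EReal.coe_ennreal_le_coe_ennreal_iff.2 h1)
    rw [EReal.coe_ennreal_ofReal, ← EReal.coe_neg]
    exact EReal.coe_le_coe_iff.2 (le_max_left _ _)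
  · rw [← EReal.real_coe_toENNReal]
    refine EReal.toENNReal_le_toENNReal ?_
    dsimp only
    rw [EReal.coe_neg, EReal.neg_le_neg_iff]
    exact iInf₂_le l hl

theorem rateOn_eq_energy (hξ : Measurable ξ) (f : PathV) (U : ℝ) :
    rateOn P ξ U f = energy (finSet P ξ) (logPsi P ξ) f 0 U := by
  rw [rateOn, energy, singPlus, singMinus, posVar_eq_incVar, posVar_eq_incVar,
    toENNReal_lamPlus, abs_lamMinus]
  congr 2
  rw [setLIntegral_congr (Ioc_ae_eq_Icc (μ := volume) (a := (0 : ℝ)) (b := U)).symm]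
  refine setLIntegral_congr_fun_ae measurableSet_Ioc ?_
  filter_upwards [f.ae_deriv_acPart] with t ht htm
  rw [ht htm.1, toENNReal_deviation P hξ]

theorem rate_eq_iSup_energy (hξ : Measurable ξ) (f : PathV) :
    rate P ξ f = ⨆ U ∈ Ioi (0 : ℝ), energy (finSet P ξ) (logPsi P ξ) f 0 U := by
  simp only [rate, rateOn_eq_energy P hξ]

theorem energy_le_rate (hξ : Measurable ξ) (f : PathV) {U : ℝ} (hU : 0 ≤ U) :
    energy (finSet P ξ) (logPsi P ξ) f 0 U ≤ rate P ξ f := by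
  rw [rate_eq_iSup_energy P hξ]
  refine le_iSup₂_of_le (max U 1) (mem_Ioi.2 (lt_max_of_lt_right one_pos)) ?_
  exact le_self_add.trans (energy_add_le _ _ f hU (le_max_left U 1))

theorem lowerSemicontinuous_rate (hξ : Measurable ξ) :
    LowerSemicontinuous fun f : PathV => rate P ξ f := by
  simp only [rate_eq_iSup_energy P hξ]
  exact lowerSemicontinuous_iSup_energy (zero_mem_finSet P ξ) (logPsi_zero P ξ)

/-- Use `e^x ≤ 1 + x e^x = 1 + x + x (e^x - 1)` and bound the last product according to the sign of
`x`. -/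
theorem exp_le_one_add_add (x : ℝ) : Real.exp x ≤ 1 + x + x ^ 2 * Real.exp |x| := by
  have key : ∀ y : ℝ, Real.exp y ≤ 1 + y * Real.exp y := fun y => by
    have h1 := Real.add_one_le_exp (-y)
    have h2 : Real.exp (-y) * Real.exp y = 1 := by rw [← Real.exp_add]; simp
    nlinarith [Real.exp_pos y]
  have hb : x * (Real.exp x - 1) ≤ x ^ 2 * Real.exp |x| := by
    rcases le_total 0 x with hx | hx
    · rw [abs_of_nonneg hx]
      nlinarith [key x, Real.exp_pos x]
    · have h1 := Real.add_one_le_exp x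
      have h2 : 1 ≤ Real.exp |x| := Real.one_le_exp (abs_nonneg x)
      nlinarith [sq_nonneg x]
  nlinarith [key x]

/-- The cumulant generating function of a centered variable is at most quadratic near `0`. -/
theorem exists_logPsi_le (hξ : Measurable ξ) {δ : ℝ} (hδ : 0 < δ)
    (hint : Integrable (fun ω => Real.exp (δ * |ξ ω|)) P) (hmean : ∫ ω, ξ ω ∂P = 0) :
    ∃ M : ℝ, 0 ≤ M ∧ ∀ l, |l| ≤ δ / 2 → l ∈ finSet P ξ ∧ logPsi P ξ l ≤ M * l ^ 2 := by
  set E := ∫ ω, Real.exp (δ * |ξ ω|) ∂P with hE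
  have hEnn : 0 ≤ E := integral_nonneg fun ω => (Real.exp_pos _).le
  -- Half of the exponential moment pays for the square: `y² / 2 ≤ e^y` at `y = δ |x| / 2` gives the
  -- constant `8 / δ²`.
  have hsq : ∀ x : ℝ, x ^ 2 * Real.exp (δ / 2 * |x|) ≤ 8 / δ ^ 2 * Real.exp (δ * |x|) := by
    intro x
    have hnn : 0 ≤ δ / 2 * |x| := by positivity
    have h1 := Real.quadratic_le_exp_of_nonneg hnn
    have h2 : Real.exp (δ * |x|) = Real.exp (δ / 2 * |x|) * Real.exp (δ / 2 * |x|) := by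
      rw [← Real.exp_add]; congr 1; ring
    have h3 : x ^ 2 ≤ 8 / δ ^ 2 * Real.exp (δ / 2 * |x|) := by
      rw [div_mul_eq_mul_div, le_div_iff₀ (by positivity), ← sq_abs x]
      nlinarith
    rw [h2, ← mul_assoc]
    exact mul_le_mul_of_nonneg_right h3 (Real.exp_pos _).le
  have hξint : Integrable ξ P := by
    refine (hint.const_mul (1 / δ)).mono' hξ.aestronglyMeasurable (Eventually.of_forall fun ω => ?_)
    have := Real.add_one_le_exp (δ * |ξ ω|)
    rw [Real.norm_eq_abs, one_div, inv_mul_eq_div, le_div_iff₀ hδ]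
    linarith
  refine ⟨8 / δ ^ 2 * E, by positivity, fun l hl => ?_⟩
  have hbound : ∀ ω, Real.exp (l * ξ ω) ≤
      1 + l * ξ ω + l ^ 2 * (8 / δ ^ 2 * Real.exp (δ * |ξ ω|)) := by
    intro ω
    refine (exp_le_one_add_add (l * ξ ω)).trans ?_
    rw [mul_pow, mul_assoc]
    have : Real.exp |l * ξ ω| ≤ Real.exp (δ / 2 * |ξ ω|) := by
      rw [Real.exp_le_exp, abs_mul]
      gcongr
    have h2 := mul_le_mul_of_nonneg_left this (sq_nonneg (ξ ω))
    have h3 := mul_le_mul_of_nonneg_left (h2.trans (hsq (ξ ω))) (sq_nonneg l)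
    linarith
  have hi1 : Integrable (fun ω => 1 + l * ξ ω) P := (integrable_const 1).add (hξint.const_mul l)
  have hi2 : Integrable (fun ω => l ^ 2 * (8 / δ ^ 2 * Real.exp (δ * |ξ ω|))) P :=
    (hint.const_mul _).const_mul _
  have hexp : Integrable (fun ω => Real.exp (l * ξ ω)) P :=
    (hi1.add hi2).mono' (by fun_prop) (Eventually.of_forall fun ω => by
      rw [Real.norm_eq_abs, abs_of_pos (Real.exp_pos _)]
      exact hbound ω)
  have hpsi : psi P ξ l = ENNReal.ofReal (∫ ω, Real.exp (l * ξ ω) ∂P) :=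
    (ofReal_integral_eq_lintegral_ofReal hexp
      (Eventually.of_forall fun ω => (Real.exp_pos _).le)).symm
  have hle : ∫ ω, Real.exp (l * ξ ω) ∂P ≤ 1 + 8 / δ ^ 2 * E * l ^ 2 := by
    refine (integral_mono hexp (hi1.add hi2) hbound).trans (le_of_eq ?_)
    have : ∫ ω, (fun ω => 1 + l * ξ ω) ω +
        (fun ω => l ^ 2 * (8 / δ ^ 2 * Real.exp (δ * |ξ ω|))) ω ∂P
        = 1 + 8 / δ ^ 2 * E * l ^ 2 := by
      rw [integral_add hi1 hi2, integral_add (integrable_const 1) (hξint.const_mul l),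
        integral_const_mul, integral_const_mul, integral_const_mul, hmean]
      simp [hE]
      ring
    exact this
  have hpos : 0 < (psi P ξ l).toReal :=
    ENNReal.toReal_pos (psi_ne_zero P hξ l) (by rw [hpsi]; exact ENNReal.ofReal_ne_top)
  refine ⟨by rw [finSet, mem_ofPred_eq, hpsi]; exact ENNReal.ofReal_lt_top, ?_⟩
  have h1 := Real.log_le_sub_one_of_pos hpos
  have h2 : (psi P ξ l).toReal ≤ 1 + 8 / δ ^ 2 * E * l ^ 2 := by
    rw [hpsi, ENNReal.toReal_ofReal (integral_nonneg fun ω => (Real.exp_pos _).le)]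
    exact hle
  rw [logPsi]
  linarith

theorem exists_growth_bound (hξ : Measurable ξ) {δ : ℝ} (hδ : 0 < δ)
    (hint : Integrable (fun ω => Real.exp (δ * |ξ ω|)) P) (hmean : ∫ ω, ξ ω ∂P = 0) :
    ∃ C : ℝ, ∀ (f : PathV) (N : ℝ), 0 ≤ N → rate P ξ f ≤ ENNReal.ofReal N →
      ∀ U : ℝ, 1 ≤ U → |f U| ≤ C * √U * max N (√N) := by
  obtain ⟨M, hM, hcgf⟩ := exists_logPsi_le P hξ hδ hint hmean
  have hlin : ∀ (f : PathV) (N : ℝ), 0 ≤ N → rate P ξ f ≤ ENNReal.ofReal N →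
      ∀ U : ℝ, 1 ≤ U → ∀ l, |l| ≤ δ / 2 → l * f U ≤ N + M * l ^ 2 * U := by
    intro f N hN hf U hU l hl
    obtain ⟨hl1, hl2⟩ := hcgf l hl
    have hU0 : 0 ≤ U := by linarith
    have h1 : ENNReal.ofReal (l * (f U - f 0) - logPsi P ξ l * (U - 0)) ≤ ENNReal.ofReal N :=
      le_trans (le_iSup_of_le (⟨l, hl1⟩ : finSet P ξ) le_rfl)
        ((chordCost_le_energy (finSet P ξ) (logPsi P ξ) f le_rfl hU0).trans
          ((energy_le_rate P hξ f hU0).trans hf))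
    rw [ENNReal.ofReal_le_ofReal_iff hN, f.eq_zero_of_nonpos 0 le_rfl] at h1
    nlinarith
  have hpos : ∀ (f : PathV) (N : ℝ), 0 < N → rate P ξ f ≤ ENNReal.ofReal N →
      ∀ U : ℝ, 1 ≤ U → |f U| ≤ (2 / δ + M * (δ / 2)) * √U * max N (√N) := by
    intro f N hN hf U hU
    have hsU : 1 ≤ √U := by rwa [Real.one_le_sqrt]
    have hsU2 : √U * √U = U := Real.mul_self_sqrt (by linarith)
    have hsN : 0 < √N := Real.sqrt_pos.2 hN
    have hsN2 : √N * √N = N := Real.mul_self_sqrt hN.le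
    -- `m` and `R` are chosen so that `m R = N` and `m ≤ R`. The slope `± (δ/2) m / √U` then stays
    -- within `δ/2`, and dividing by it gives `C √U R` in both regimes of `N`.
    set m := min (√N) 1 with hm
    have hm0 : 0 < m := lt_min hsN one_pos
    set R := max N (√N) with hR
    have hmR : m * R = N := by
      rcases le_total (√N) 1 with h | h
      · rw [hm, hR, min_eq_left h, max_eq_right (by nlinarith)]; exact hsN2
      · rw [hm, hR, min_eq_right h, max_eq_left (by nlinarith), one_mul]
    have hmR' : m ≤ R := (min_le_left _ _).trans (le_max_right _ _)
    have key : ∀ l, |l| = δ / 2 * (m / √U) → l * f U ≤ δ / 2 * (m / √U) *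
        ((2 / δ + M * (δ / 2)) * √U * R) := by
      intro l hl
      have hl' : |l| ≤ δ / 2 := by
        rw [hl]
        have : m / √U ≤ 1 := (div_le_one (by linarith)).2 ((min_le_right _ _).trans hsU)
        nlinarith
      have h1 := hlin f N hN.le hf U hU l hl'
      have h2 : M * l ^ 2 * U = M * (δ / 2) ^ 2 * m ^ 2 := by
        have h3 : l ^ 2 * U = (δ / 2) ^ 2 * m ^ 2 := by
          rw [← sq_abs, hl, mul_pow, div_pow m, Real.sq_sqrt (by linarith)]
          field_simp
        rw [mul_assoc, h3, mul_assoc]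
      have h3 : δ / 2 * (m / √U) * ((2 / δ + M * (δ / 2)) * √U * R) =
          N + M * (δ / 2) ^ 2 * (m * R) := by
        rw [← hmR]
        field_simp
      rw [h3]
      rw [h2] at h1
      have h4 : m ^ 2 ≤ m * R := by nlinarith
      have h5 := mul_le_mul_of_nonneg_left h4 (by positivity : 0 ≤ M * (δ / 2) ^ 2)
      linarith
    have hlam : 0 < δ / 2 * (m / √U) := by positivity
    have k1 := key _ (abs_of_pos hlam)
    have k2 := key (-(δ / 2 * (m / √U))) (by rw [abs_neg, abs_of_pos hlam])
    rw [abs_le]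
    constructor
    · rw [neg_mul, ← mul_neg] at k2
      linarith [le_of_mul_le_mul_left k2 hlam]
    · exact le_of_mul_le_mul_left k1 hlam
  refine ⟨2 / δ + M * (δ / 2), fun f N hN hf U hU => ?_⟩
  rcases hN.eq_or_lt with rfl | hN'
  -- For `N = 0` the chosen slope would vanish, so the bound is obtained as a limit from `N > 0`.
  · have hlim : Tendsto (fun N : ℝ => (2 / δ + M * (δ / 2)) * √U * max N (√N)) (𝓝[>] 0)
        (𝓝 ((2 / δ + M * (δ / 2)) * √U * max 0 (√0))) := by
      have : Continuous fun N : ℝ => (2 / δ + M * (δ / 2)) * √U * max N (√N) := by fun_prop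
      exact (this.tendsto 0).mono_left nhdsWithin_le_nhds
    refine ge_of_tendsto hlim ?_
    filter_upwards [self_mem_nhdsWithin] with N hN
    exact hpos f N hN (hf.trans (ENNReal.ofReal_le_ofReal (le_of_lt hN))) U hU
  · exact hpos f N hN' hf U hU

end Cumulant

/-! ### Approximation by piecewise linear paths -/

theorem eventually_nhds_of_sides {p : ℝ → Prop} {r : ℝ} (hl : ∀ᶠ x in 𝓝[<] r, p x) (h : p r)
    (hr : ∀ᶠ x in 𝓝[>] r, p x) : ∀ᶠ x in 𝓝 r, p x := by
  rw [← nhdsLT_sup_nhdsGE, eventually_sup]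
  refine ⟨hl, ?_⟩
  rw [← Ioi_insert, nhdsWithin_insert, eventually_sup]
  exact ⟨h, hr⟩

/-- The intermediate value theorem for completed graphs. -/
theorem exists_mem_uIcc_of_le {g L R : ℝ → ℝ} (hL : ∀ r, Tendsto g (𝓝[<] r) (𝓝 (L r)))
    (hR : ∀ r, Tendsto g (𝓝[>] r) (𝓝 (R r))) (hg : ∀ r, g r ∈ uIcc (L r) (R r)) {s t a : ℝ}
    (hst : s ≤ t) (hs : g s ≤ a) (ht : a ≤ g t) : ∃ r ∈ Icc s t, a ∈ uIcc (L r) (R r) := by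
  rcases ht.eq_or_lt with rfl | ht
  · exact ⟨t, ⟨hst, le_rfl⟩, hg t⟩
  -- Let `r` be the last point approached by `{g ≤ a}`. If `a` were below both limits, `g > a` near
  -- `r`; if above both, `A` would contain points to the right of `r`.
  set A := {x | x ∈ Icc s t ∧ g x ≤ a}
  have hsA : s ∈ A := ⟨⟨le_rfl, hst⟩, hs⟩
  have hbdd : BddAbove A := ⟨t, fun x hx => hx.1.2⟩
  have hlub := isLUB_csSup ⟨s, hsA⟩ hbdd
  set r := sSup A
  have hrs : s ≤ r := hlub.1 hsA
  have hrt : r ≤ t := hlub.2 fun x hx => hx.1.2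
  refine ⟨r, ⟨hrs, hrt⟩, ?_⟩
  have hgr := hg r
  rw [uIcc, mem_Icc] at hgr ⊢
  constructor
  · by_contra! hcon
    rw [lt_inf_iff] at hcon
    have hev := eventually_nhds_of_sides ((hL r).eventually (lt_mem_nhds hcon.1))
      ((lt_inf_iff.2 hcon).trans_le hgr.1) ((hR r).eventually (lt_mem_nhds hcon.2))
    obtain ⟨x, hx, hxA⟩ := mem_closure_iff_nhds.1 (hlub.mem_closure ⟨s, hsA⟩) _ hev
    exact absurd hxA.2 (not_le.2 hx)
  · by_contra! hcon
    rw [sup_lt_iff] at hcon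
    have hgra := hgr.2.trans_lt (sup_lt_iff.2 hcon)
    have hrt' : r < t := lt_of_le_of_ne hrt fun h => by rw [h] at hgra; linarith
    obtain ⟨x, hx, hx'⟩ := (((hR r).eventually (gt_mem_nhds hcon.2)).and
      (Ioo_mem_nhdsGT hrt')).exists
    exact absurd (hlub.1 (⟨⟨hrs.trans hx'.1.le, hx'.2.le⟩, le_of_lt hx⟩ : x ∈ A)) (not_le.2 hx'.1)

theorem PathV.exists_mem_uIcc (f : PathV) {s t a : ℝ} (hst : s ≤ t) (ha : a ∈ uIcc (f s) (f t)) :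
    ∃ r ∈ Icc s t, a ∈ uIcc (Function.leftLim f r) (Function.rightLim f r) := by
  rcases Set.mem_uIcc.1 ha with h | h
  · exact exists_mem_uIcc_of_le f.tendsto_leftLim f.tendsto_rightLim f.mem_uIcc hst h.1 h.2
  · obtain ⟨r, hr, hr'⟩ := exists_mem_uIcc_of_le (g := fun x => -f x) (a := -a)
      (fun r => (f.tendsto_leftLim r).neg) (fun r => (f.tendsto_rightLim r).neg)
      (fun r => by
        have := f.mem_uIcc r
        rw [Set.mem_uIcc] at this ⊢
        rcases this with h | h
        · exact Or.inr ⟨neg_le_neg h.2, neg_le_neg h.1⟩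
        · exact Or.inl ⟨neg_le_neg h.2, neg_le_neg h.1⟩) hst (neg_le_neg h.2) (neg_le_neg h.1)
    refine ⟨r, hr, ?_⟩
    rw [Set.mem_uIcc] at hr' ⊢
    rcases hr' with h | h
    · exact Or.inr ⟨neg_le_neg_iff.1 h.2, neg_le_neg_iff.1 h.1⟩
    · exact Or.inl ⟨neg_le_neg_iff.1 h.2, neg_le_neg_iff.1 h.1⟩

/-- On short intervals, a path does not overshoot the values at the end points by more than `ε`. -/
theorem PathV.exists_local_modulus (f : PathV) {ε : ℝ} (hε : 0 < ε) (x : ℝ) :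
    ∃ δ > 0, ∀ s ∈ Metric.ball x δ, ∀ t ∈ Metric.ball x δ, ∀ r ∈ Icc s t,
      f r ∈ Icc (f s ⊓ f t - ε) (f s ⊔ f t + ε) := by
  have h1 : ∀ᶠ y in 𝓝[<] x, |f y - Function.leftLim f x| < ε / 2 :=
    (Metric.tendsto_nhds.1 (f.tendsto_leftLim x)) _ (half_pos hε)
  have h2 : ∀ᶠ y in 𝓝[>] x, |f y - Function.rightLim f x| < ε / 2 :=
    (Metric.tendsto_nhds.1 (f.tendsto_rightLim x)) _ (half_pos hε)
  rw [eventually_nhdsWithin_iff] at h1 h2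
  obtain ⟨δ, hδ, hball⟩ := Metric.eventually_nhds_iff_ball.1 (h1.and h2)
  refine ⟨δ, hδ, fun s hs t ht r hr => ?_⟩
  have hrb : r ∈ Metric.ball x δ := by
    rw [Metric.mem_ball, Real.dist_eq, abs_lt] at hs ht ⊢
    constructor <;> linarith [hr.1, hr.2]
  have i1 : f s ⊓ f t ≤ f s := inf_le_left
  have i2 : f s ⊓ f t ≤ f t := inf_le_right
  have i3 : f s ≤ f s ⊔ f t := le_sup_left
  have i4 : f t ≤ f s ⊔ f t := le_sup_right
  rcases lt_trichotomy r x with h | h | h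
  · have a1 := abs_lt.1 ((hball r hrb).1 h)
    have a2 := abs_lt.1 ((hball s hs).1 (hr.1.trans_lt h))
    constructor <;> linarith
  · subst h
    rcases hr.1.eq_or_lt with rfl | hsr
    · constructor <;> linarith
    rcases hr.2.eq_or_lt with rfl | hrt
    · constructor <;> linarith
    have a1 := abs_lt.1 ((hball s hs).1 hsr)
    have a2 := abs_lt.1 ((hball t ht).2 hrt)
    rcases Set.mem_uIcc.1 (f.mem_uIcc r) with h | h <;> constructor <;> linarith
  · have a1 := abs_lt.1 ((hball r hrb).2 h)
    have a2 := abs_lt.1 ((hball t ht).2 (h.trans_le hr.2))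
    constructor <;> linarith

/-- A Lebesgue number of the cover of `[0, T]` by the local balls makes the modulus uniform. -/
theorem PathV.exists_modulus (f : PathV) {ε : ℝ} (hε : 0 < ε) (T : ℝ) :
    ∃ δ > 0, ∀ s t, 0 ≤ s → s ≤ T → t - s < δ → ∀ r ∈ Icc s t,
      f r ∈ Icc (f s ⊓ f t - ε) (f s ⊔ f t + ε) := by
  choose δ hδ hball using f.exists_local_modulus hε
  obtain ⟨η, hη, hsub⟩ := lebesgue_number_lemma_of_metric (isCompact_Icc (a := (0 : ℝ)) (b := T))
    (c := fun x : ℝ => Metric.ball x (δ x)) (fun _ => Metric.isOpen_ball)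
    (fun x _ => mem_iUnion.2 ⟨x, Metric.mem_ball_self (hδ x)⟩)
  refine ⟨η, hη, fun s t hs hT hst r hr => ?_⟩
  obtain ⟨x, hx⟩ := hsub s ⟨hs, hT⟩
  refine hball x s (hx (Metric.mem_ball_self hη)) t (hx ?_) r hr
  rw [Metric.mem_ball, Real.dist_eq, abs_of_nonneg (by linarith [hr.1, hr.2])]
  exact hst

theorem PathV.exists_bound (f : PathV) (T : ℝ) : ∃ B > 0, ∀ r ≤ T, |f r| ≤ B := by
  have hT : 0 < max T 1 := lt_max_of_lt_right one_pos
  have hbv := f.boundedVariation _ hT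
  refine ⟨(eVariationOn f (Icc 0 (max T 1))).toReal + 1, by positivity, fun r hr => ?_⟩
  rcases le_or_gt r 0 with h | h
  · rw [f.eq_zero_of_nonpos r h, abs_zero]
    positivity
  · have := hbv.dist_le (x := r) (y := 0) ⟨h.le, hr.trans (le_max_left _ _)⟩ ⟨le_rfl, hT.le⟩
    rw [Real.dist_eq, f.eq_zero_of_nonpos 0 le_rfl, sub_zero] at this
    linarith

/-- The step size depends on the unit interval reached. Bounded nodes would meet finitely many step
sizes, hence steps bounded away from `0`, contradicting convergence. -/
theorem exists_nodes {d : ℕ → ℝ} (hd : ∀ k, 0 < d k) : ∃ s : ℕ → ℝ, StrictMono s ∧ s 0 = 0 ∧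
    Tendsto s atTop atTop ∧ ∀ i, s (i + 1) - s i = d ⌊s i⌋₊ := by
  let s : ℕ → ℝ := fun n => Nat.rec 0 (fun _ x => x + d ⌊x⌋₊) n
  have hsucc : ∀ i, s (i + 1) = s i + d ⌊s i⌋₊ := fun i => rfl
  have hmono : StrictMono s := strictMono_nat_of_lt_succ fun i => by
    rw [hsucc]; linarith [hd ⌊s i⌋₊]
  refine ⟨s, hmono, rfl, ?_, fun i => by rw [hsucc]; ring⟩
  rcases tendsto_atTop_of_monotone hmono.monotone with h | ⟨l, hl⟩
  · exact h
  exfalso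
  have hle : ∀ i, s i ≤ l := fun i => hmono.monotone.ge_of_tendsto hl i
  obtain ⟨k, -, hk⟩ := Finset.exists_min_image (Finset.range (⌊l⌋₊ + 1)) d ⟨0, by simp⟩
  have hdiff : Tendsto (fun i => s (i + 1) - s i) atTop (𝓝 0) := by
    simpa using (hl.comp (tendsto_add_atTop_nat 1)).sub hl
  have := ge_of_tendsto' hdiff (b := d k) fun i => by
    rw [hsucc, add_sub_cancel_left]
    exact hk _ (Finset.mem_range.2 (Nat.lt_succ_of_le (Nat.floor_mono (hle i))))
  linarith [hd k]

theorem PathV.exists_fine_partition (f : PathV) {ε : ℝ} (hε : 0 < ε) :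
    ∃ s : ℕ → ℝ, StrictMono s ∧ s 0 = 0 ∧ Tendsto s atTop atTop ∧
      ∀ i, s (i + 1) - s i ≤ ε ∧ ∀ r ∈ Icc (s i) (s (i + 1)),
        |f r| * (s (i + 1) - s i) ≤ ε ∧
        f r ∈ Icc (f (s i) ⊓ f (s (i + 1)) - ε) (f (s i) ⊔ f (s (i + 1)) + ε) := by
  -- On the half-line the mesh must vary. A node with floor `k` is below `k + 1`, and since steps
  -- are at most `1` its cell is below `k + 2`.
  choose δ hδ hmod using fun k : ℕ => f.exists_modulus hε (k + 1)
  choose B hB hbound using fun k : ℕ => f.exists_bound (k + 2)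
  let d : ℕ → ℝ := fun k => min (min 1 ε) (min (δ k / 2) (ε / B k))
  have hd : ∀ k, 0 < d k := fun k => by
    have := hδ k
    have := hB k
    positivity
  obtain ⟨s, hs, hs0, hlim, hdiff⟩ := exists_nodes hd
  have d1 : ∀ k, d k ≤ 1 := fun k => (min_le_left _ _).trans (min_le_left _ _)
  have d2 : ∀ k, d k ≤ ε := fun k => (min_le_left _ _).trans (min_le_right _ _)
  have d3 : ∀ k, d k ≤ δ k / 2 := fun k => (min_le_right _ _).trans (min_le_left _ _)
  have d4 : ∀ k, d k ≤ ε / B k := fun k => (min_le_right _ _).trans (min_le_right _ _)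
  refine ⟨s, hs, hs0, hlim, fun i => ⟨by rw [hdiff]; exact d2 _, fun r hr => ⟨?_, ?_⟩⟩⟩
  all_goals have hfl := (Nat.lt_floor_add_one (s i)).le
  · have h1 : |f r| ≤ B ⌊s i⌋₊ := hbound _ r (by linarith [hr.2, hdiff i, d1 ⌊s i⌋₊])
    rw [hdiff]
    calc |f r| * d ⌊s i⌋₊ ≤ B ⌊s i⌋₊ * (ε / B ⌊s i⌋₊) := by
          gcongr
          · exact (hd _).le
          · exact (hB _).le
          · exact d4 _
      _ = ε := mul_div_cancel₀ _ (hB _).ne'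
  · refine hmod ⌊s i⌋₊ (s i) (s (i + 1)) (hs0 ▸ hs.monotone (Nat.zero_le i)) hfl ?_ r hr
    rw [hdiff]
    linarith [d3 ⌊s i⌋₊, hδ ⌊s i⌋₊]

/-! ### Piecewise linear interpolation -/

theorem exists_mem_Ico {u : ℕ → ℝ} (hlim : Tendsto u atTop atTop) {t : ℝ} (ht : u 0 ≤ t) :
    ∃ i, t ∈ Ico (u i) (u (i + 1)) := by
  classical
  have hex : ∃ n, t < u n := (hlim.eventually (eventually_gt_atTop t)).exists
  obtain ⟨i, hi⟩ : ∃ i, Nat.find hex = i + 1 := Nat.exists_eq_succ_of_ne_zero fun h => by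
    have := Nat.find_spec hex
    rw [h] at this
    exact absurd ht (not_le.2 this)
  refine ⟨i, not_lt.1 (Nat.find_min hex (by omega)), ?_⟩
  rw [← hi]
  exact Nat.find_spec hex

theorem exists_mem_Ioc_of_tendsto {u : ℕ → ℝ} (hlim : Tendsto u atTop atTop) {t : ℝ}
    (ht : u 0 < t) : ∃ i, t ∈ Ioc (u i) (u (i + 1)) := by
  obtain ⟨n, hn⟩ := (hlim.eventually (eventually_ge_atTop t)).exists
  obtain ⟨i, -, hi⟩ := exists_mem_Ioc ⟨ht, hn⟩
  exact ⟨i, hi⟩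

/-- The derivative of the piecewise linear interpolation of `f` at the nodes `u`. -/
def interpSlope (f : ℝ → ℝ) (u : ℕ → ℝ) : ℝ → ℝ := (Ioi 0).indicator (stepSlope f u)

/-- The piecewise linear interpolation of `f` at the nodes `u`. -/
def interp (f : ℝ → ℝ) (u : ℕ → ℝ) (t : ℝ) : ℝ := ∫ x in (0 : ℝ)..t, interpSlope f u x

section Interp

variable {f : ℝ → ℝ} {u : ℕ → ℝ} (hu : StrictMono u) (hu0 : u 0 = 0)
  (hlim : Tendsto u atTop atTop)

include hu hu0

theorem interpSlope_eq {i : ℕ} {t : ℝ} (ht : t ∈ Ioc (u i) (u (i + 1))) :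
    interpSlope f u t = (f (u (i + 1)) - f (u i)) / (u (i + 1) - u i) := by
  have h0 : 0 < t := (hu0 ▸ hu.monotone (Nat.zero_le i)).trans_lt ht.1
  rw [interpSlope, indicator_of_mem (mem_Ioi.2 h0), stepSlope_eq f hu.monotone ht]

theorem intervalIntegrable_interpSlope_node (n : ℕ) :
    IntervalIntegrable (interpSlope f u) volume 0 (u n) := by
  rw [← hu0]
  refine IntervalIntegrable.trans_iterate fun k _ => ?_
  rw [intervalIntegrable_iff_integrableOn_Ioc_of_le (hu.monotone k.le_succ)]
  exact (integrableOn_const (C := (f (u (k + 1)) - f (u k)) / (u (k + 1) - u k))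
    (by simp)).congr_fun (fun t ht => (interpSlope_eq hu hu0 ht).symm) measurableSet_Ioc

include hlim

theorem intervalIntegrable_interpSlope (a b : ℝ) :
    IntervalIntegrable (interpSlope f u) volume a b := by
  have key : ∀ T, IntervalIntegrable (interpSlope f u) volume 0 T := by
    intro T
    rcases le_total T 0 with h | h
    · have : IntervalIntegrable (fun _ => (0 : ℝ)) volume 0 T := intervalIntegrable_const
      refine this.congr fun t ht => ?_
      rw [uIoc_of_ge h] at ht
      exact (indicator_of_notMem (not_lt.2 ht.2) _).symm
    · obtain ⟨n, hn⟩ := (hlim.eventually (eventually_ge_atTop T)).exists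
      refine (intervalIntegrable_interpSlope_node hu hu0 n).mono_set ?_
      rw [uIcc_of_le h, uIcc_of_le (h.trans hn)]
      exact Icc_subset_Icc_right hn
  exact (key a).symm.trans (key b)

theorem interp_of_mem {i : ℕ} {t : ℝ} (ht : t ∈ Icc (u i) (u (i + 1))) :
    interp f u t = interp f u (u i) +
      (f (u (i + 1)) - f (u i)) / (u (i + 1) - u i) * (t - u i) := by
  have hint := intervalIntegrable_interpSlope (f := f) hu hu0 hlim
  have hconst : ∫ x in (u i)..t, interpSlope f u x =
      ∫ _ in (u i)..t, (f (u (i + 1)) - f (u i)) / (u (i + 1) - u i) := by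
    refine intervalIntegral.integral_congr_ae (Eventually.of_forall fun x hx => ?_)
    rw [uIoc_of_le ht.1] at hx
    exact interpSlope_eq hu hu0 ⟨hx.1, hx.2.trans ht.2⟩
  rw [interp, interp, ← intervalIntegral.integral_add_adjacent_intervals (hint 0 (u i))
    (hint (u i) t), hconst, intervalIntegral.integral_const, smul_eq_mul, mul_comm (t - u i)]

theorem interp_node (hf : f 0 = 0) (n : ℕ) : interp f u (u n) = f (u n) := by
  induction n with
  | zero => simp [hu0, hf, interp]
  | succ k ih =>
    have h := hu k.lt_succ_self
    rw [interp_of_mem hu hu0 hlim ⟨h.le, le_rfl⟩, ih, div_mul_cancel₀ _ (sub_pos.2 h).ne']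
    ring

theorem interp_mem_uIcc (hf : f 0 = 0) {i : ℕ} {t : ℝ} (ht : t ∈ Icc (u i) (u (i + 1))) :
    interp f u t ∈ uIcc (f (u i)) (f (u (i + 1))) := by
  have h : 0 < u (i + 1) - u i := sub_pos.2 (hu i.lt_succ_self)
  rw [interp_of_mem hu hu0 hlim ht, interp_node hu hu0 hlim hf, ← segment_eq_uIcc,
    segment_eq_image']
  refine ⟨(t - u i) / (u (i + 1) - u i), ⟨div_nonneg (by linarith [ht.1]) h.le,
    (div_le_one h).2 (by linarith [ht.2])⟩, ?_⟩
  simp only [smul_eq_mul]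
  ring

theorem continuous_interp : Continuous (interp f u) :=
  intervalIntegral.continuous_primitive (intervalIntegrable_interpSlope hu hu0 hlim) 0

theorem absolutelyContinuousOnInterval_interp (a b : ℝ) (h : (0 : ℝ) ∈ uIcc a b) :
    AbsolutelyContinuousOnInterval (interp f u) a b :=
  (intervalIntegrable_interpSlope hu hu0 hlim a
    b).absolutelyContinuousOnInterval_intervalIntegral h

theorem deriv_interp {i : ℕ} {t : ℝ} (ht : t ∈ Ioo (u i) (u (i + 1))) :
    deriv (interp f u) t = (f (u (i + 1)) - f (u i)) / (u (i + 1) - u i) := by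
  have hev : interp f u =ᶠ[𝓝 t] fun t => interp f u (u i) +
      (f (u (i + 1)) - f (u i)) / (u (i + 1) - u i) * (t - u i) := by
    filter_upwards [Icc_mem_nhds ht.1 ht.2] with x hx using interp_of_mem hu hu0 hlim hx
  rw [hev.deriv_eq]
  simp

theorem singPart_interp {t : ℝ} : singPart (interp f u) t = 0 := by
  have h := (absolutelyContinuousOnInterval_interp (f := f) hu hu0 hlim 0 t
    (by simp)).integral_deriv_eq_sub
  rw [singPart, acPart, h]
  simp [interp]

theorem energy_interp (S : Set ℝ) (φ : ℝ → ℝ) (n : ℕ) : energy S φ (interp f u) 0 (u n) =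
    ∑ i ∈ Finset.range n, chordCost S φ f (u i) (u (i + 1)) := by
  have h1 : incVar (singPart (interp f u)) 0 (u n) = 0 := by
    simp [incVar, singPart_interp hu hu0 hlim]
  have h2 : incVar (fun t => -singPart (interp f u) t) 0 (u n) = 0 := by
    simp [incVar, singPart_interp hu hu0 hlim]
  have h3 := lintegral_Ioc_eq_sum (fun t => conj S φ (deriv (interp f u) t)) hu.monotone n
  rw [hu0] at h3
  rw [energy, h1, h2, mul_zero, mul_zero, add_zero, add_zero, h3]
  refine Finset.sum_congr rfl fun i _ => ?_
  rw [← setLIntegral_congr Ioo_ae_eq_Ioc, setLIntegral_congr_fun measurableSet_Ioo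
    (fun t ht => by rw [deriv_interp hu hu0 hlim ht]), setLIntegral_const, Real.volume_Ioo,
    conj_mul_eq_chordCost _ _ _ (hu i.lt_succ_self)]

end Interp

/-- The piecewise linear interpolation of a path, as a path. -/
def interpV (f : PathV) {u : ℕ → ℝ} (hu : StrictMono u) (hu0 : u 0 = 0)
    (hlim : Tendsto u atTop atTop) : PathV where
  toFun := interp f u
  eq_zero_of_nonpos t ht := by
    rw [interp, intervalIntegral.integral_congr_ae (g := fun _ => 0)]
    · simp
    · refine Eventually.of_forall fun x hx => ?_
      rw [uIoc_of_ge ht] at hx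
      exact indicator_of_notMem (not_lt.2 hx.2) _
  boundedVariation T hT := by
    rw [← uIcc_of_le hT.le]
    exact (absolutelyContinuousOnInterval_interp hu hu0 hlim 0 T (by simp)).boundedVariationOn
  mem_uIcc t := by
    rw [((continuous_interp hu hu0 hlim).continuousAt.continuousWithinAt).leftLim_eq]
    exact left_mem_uIcc

/-- The interpolation costs exactly the sum of its chord costs, each at most the rate of `f` over
that cell. -/
theorem iSup_energy_interpV_le {S : Set ℝ} {φ : ℝ → ℝ} (f : PathV) {u : ℕ → ℝ} (hu : StrictMono u)
    (hu0 : u 0 = 0) (hlim : Tendsto u atTop atTop) :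
    ⨆ U ∈ Ioi (0 : ℝ), energy S φ (interpV f hu hu0 hlim) 0 U ≤
      ⨆ U ∈ Ioi (0 : ℝ), energy S φ f 0 U := by
  refine iSup₂_le fun U hU => ?_
  obtain ⟨n, hn⟩ := (hlim.eventually (eventually_ge_atTop U)).exists
  have hpos : ∀ i, 0 ≤ u i := fun i => hu0 ▸ hu.monotone (Nat.zero_le i)
  refine le_iSup₂_of_le (u n) (lt_of_lt_of_le hU hn) ?_
  refine (le_self_add.trans (energy_add_le S φ _ (le_of_lt hU) hn)).trans ?_
  have h1 : energy S φ (interpV f hu hu0 hlim) 0 (u n) =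
    ∑ i ∈ Finset.range n, chordCost S φ f (u i) (u (i + 1)) := energy_interp hu hu0 hlim S φ n
  rw [h1]
  have h2 := sum_le_of_superadditive (E := energy S φ f) (fun _ _ _ => energy_add_le S φ f)
    hu.monotone n
  rw [hu0] at h2
  exact (Finset.sum_le_sum fun i _ => chordCost_le_energy S φ f (hpos i)
    (hu.monotone i.le_succ)).trans h2

/-! ### Distance from a path to its interpolation -/

theorem abs_div_sub_div_le {a b r s : ℝ} :
    |a / (1 + |r|) - b / (1 + |s|)| ≤ |a - b| + |b| * |r - s| := by
  have hr : 0 < 1 + |r| := by positivity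
  have hs : 0 < 1 + |s| := by positivity
  have e : a / (1 + |r|) - b / (1 + |s|) =
      (a - b) / (1 + |r|) + b * (|s| - |r|) / ((1 + |r|) * (1 + |s|)) := by
    field_simp
    ring
  rw [e]
  refine (abs_add_le _ _).trans (add_le_add ?_ ?_)
  · rw [abs_div, abs_of_pos hr]
    exact div_le_self (abs_nonneg _) (by linarith [abs_nonneg r])
  · rw [abs_div, abs_mul, abs_of_pos (mul_pos hr hs), abs_sub_comm r s]
    refine (div_le_self (by positivity) (by nlinarith [abs_nonneg r, abs_nonneg s])).trans ?_
    exact mul_le_mul_of_nonneg_left (abs_abs_sub_abs_le_abs_sub s r) (abs_nonneg _)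

theorem edist_graph_le {a b r s ε : ℝ} (h1 : |r - s| ≤ ε) (h2 : |a - b| ≤ ε)
    (h3 : |b| * |r - s| ≤ ε) :
    edist (r, a / (1 + |r|)) (s, b / (1 + |s|)) ≤ ENNReal.ofReal (2 * ε) := by
  have hε : 0 ≤ ε := (abs_nonneg _).trans h1
  rw [edist_dist]
  refine ENNReal.ofReal_le_ofReal ?_
  rw [Prod.dist_eq, max_le_iff, Real.dist_eq, Real.dist_eq]
  exact ⟨by simp only; linarith, abs_div_sub_div_le.trans (by linarith)⟩

theorem exists_near_of_mem_Icc {m M y ε : ℝ} (hm : m ≤ M) (hy : y ∈ Icc (m - ε) (M + ε))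
    (hε : 0 ≤ ε) : ∃ β ∈ Icc m M, |y - β| ≤ ε := by
  rcases le_total y m with h | h
  · exact ⟨m, ⟨le_rfl, hm⟩, by rw [abs_le]; constructor <;> linarith [hy.1]⟩
  rcases le_total M y with h' | h'
  · exact ⟨M, ⟨hm, le_rfl⟩, by rw [abs_le]; constructor <;> linarith [hy.2]⟩
  · exact ⟨y, ⟨h, h'⟩, by simpa using hε⟩

/-- Points are matched inside one cell, with equal or `ε`-close unweighted heights; the condition on
`|f r|` times the mesh controls the change of weight between their abscissas. -/
theorem rho_interpV_le (f : PathV) {u : ℕ → ℝ} (hu : StrictMono u) (hu0 : u 0 = 0)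
    (hlim : Tendsto u atTop atTop) {ε : ℝ} (hε : 0 < ε)
    (hfine : ∀ i, u (i + 1) - u i ≤ ε ∧ ∀ r ∈ Icc (u i) (u (i + 1)),
        |f r| * (u (i + 1) - u i) ≤ ε ∧
        f r ∈ Icc (f (u i) ⊓ f (u (i + 1)) - ε) (f (u i) ⊔ f (u (i + 1)) + ε)) :
    rho (interpV f hu hu0 hlim) f ≤ ENNReal.ofReal (2 * ε) := by
  have hf0 : f 0 = 0 := f.eq_zero_of_nonpos 0 le_rfl
  set F := interpV f hu hu0 hlim with hF
  have hFc : Continuous F := continuous_interp hu hu0 hlim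
  have hdist : ∀ {i r s}, r ∈ Icc (u i) (u (i + 1)) → s ∈ Icc (u i) (u (i + 1)) →
      |r - s| ≤ u (i + 1) - u i := fun hr hs => by
    rw [abs_le]; constructor <;> linarith [hr.1, hr.2, hs.1, hs.2]
  have hval : ∀ {i b}, b ∈ uIcc (f (u i)) (f (u (i + 1))) → |b| * (u (i + 1) - u i) ≤ ε := by
    intro i b hb
    have hle := hu.monotone i.le_succ
    have h1 := ((hfine i).2 _ ⟨le_rfl, hle⟩).1
    have h2 := ((hfine i).2 _ ⟨hle, le_rfl⟩).1
    have h3 : |b| ≤ max |f (u i)| |f (u (i + 1))| := by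
      rcases Set.mem_uIcc.1 hb with h | h
      · exact abs_le_max_abs_abs h.1 h.2
      · rw [max_comm]; exact abs_le_max_abs_abs h.1 h.2
    have h4 : 0 ≤ u (i + 1) - u i := by linarith
    rcases max_choice |f (u i)| |f (u (i + 1))| with h | h <;> rw [h] at h3 <;>
      nlinarith
  refine Metric.hausdorffEDist_le_of_mem_edist ?_ ?_
  · rintro ⟨r, α⟩ hα
    have hα' := (F.mem_graph_hat_iff r α).1 hα
    rw [hFc.continuousAt.continuousWithinAt.leftLim_eq,
      hFc.continuousAt.continuousWithinAt.rightLim_eq, uIcc_self, mem_singleton_iff] at hα'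
    have hαe : α = F r / (1 + |r|) := by
      rw [← hα', mul_div_cancel_right₀ _ (by positivity)]
    rcases le_or_gt r 0 with hr | hr
    · refine ⟨(r, hat f r), f.mem_graph_hat r, ?_⟩
      rw [hαe, hat, f.eq_zero_of_nonpos r hr, F.eq_zero_of_nonpos r hr, edist_self]
      exact zero_le
    · obtain ⟨i, hi⟩ := exists_mem_Ioc_of_tendsto hlim (by rwa [hu0] : u 0 < r)
      have hi' := Ioc_subset_Icc_self hi
      have hFr : F r ∈ uIcc (f (u i)) (f (u (i + 1))) := interp_mem_uIcc hu hu0 hlim hf0 hi'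
      -- The completed graph of `f` attains the height `F r` exactly somewhere in the cell.
      obtain ⟨s, hs, hs'⟩ := f.exists_mem_uIcc (hu.monotone i.le_succ) hFr
      refine ⟨(s, F r / (1 + |s|)), ?_, ?_⟩
      · rw [f.mem_graph_hat_iff, div_mul_cancel₀ _ (by positivity)]
        exact hs'
      · rw [hαe]
        refine edist_graph_le ((hdist hi' hs).trans (hfine i).1) (by simpa using hε.le) ?_
        exact (mul_le_mul_of_nonneg_left (hdist hi' hs) (abs_nonneg _)).trans (hval hFr)
  · rintro ⟨r, α⟩ hα
    have hα' := (f.mem_graph_hat_iff r α).1 hα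
    set a := α * (1 + |r|)
    have hαe : α = a / (1 + |r|) := (mul_div_cancel_right₀ _ (by positivity)).symm
    have hzero : r ≤ 0 → a = 0 → ∃ y ∈ graph (hat F), edist (r, α) y ≤ ENNReal.ofReal (2 * ε) := by
      intro hr ha
      refine ⟨(r, hat F r), F.mem_graph_hat r, ?_⟩
      rw [hαe, ha, hat, F.eq_zero_of_nonpos r hr, edist_self]
      exact zero_le
    have hmain : ∀ i, r ∈ Icc (u i) (u (i + 1)) →
        a ∈ Icc (f (u i) ⊓ f (u (i + 1)) - ε) (f (u i) ⊔ f (u (i + 1)) + ε) →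
        ∃ y ∈ graph (hat F), edist (r, α) y ≤ ENNReal.ofReal (2 * ε) := by
      intro i hi ha
      obtain ⟨β, hβ, hβ'⟩ := exists_near_of_mem_Icc inf_le_sup ha hε.le
      have hβu : β ∈ uIcc (F (u i)) (F (u (i + 1))) := by
        have e1 : F (u i) = f (u i) := interp_node hu hu0 hlim hf0 i
        have e2 : F (u (i + 1)) = f (u (i + 1)) := interp_node hu hu0 hlim hf0 (i + 1)
        rw [e1, e2]
        exact hβ
      obtain ⟨s, hs, rfl⟩ := intermediate_value_uIcc hFc.continuousOn hβu
      rw [uIcc_of_le (hu.monotone i.le_succ)] at hs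
      refine ⟨(s, hat F s), F.mem_graph_hat s, ?_⟩
      rw [hαe, hat]
      refine edist_graph_le ((hdist hi hs).trans (hfine i).1) hβ' ?_
      exact (mul_le_mul_of_nonneg_left (hdist hi hs) (abs_nonneg _)).trans (hval hβ)
    have hleft0 : r ≤ 0 → Function.leftLim f r = 0 := fun hr =>
      leftLim_eq_of_tendsto (tendsto_const_nhds.congr' (by
        filter_upwards [self_mem_nhdsWithin] with s hs
        exact (f.eq_zero_of_nonpos s (le_trans (le_of_lt hs) hr)).symm))
    -- The vertical segment is split at `f r`, as `r` may be a node: the left half belongs to the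
    -- cell ending at or after `r`, the right half to the cell starting at or before it.
    rcases uIcc_subset_uIcc_union_uIcc (b := f r) hα' with ha | ha
    · rcases le_or_gt r 0 with hr | hr
      · refine hzero hr ?_
        rwa [hleft0 hr, f.eq_zero_of_nonpos r hr, uIcc_self, mem_singleton_iff] at ha
      · obtain ⟨i, hi⟩ := exists_mem_Ioc_of_tendsto hlim (by rwa [hu0] : u 0 < r)
        have hi' := Ioc_subset_Icc_self hi
        refine hmain i hi' (ordConnected_Icc.uIcc_subset ?_ ((hfine i).2 r hi').2 ha)
        refine isClosed_Icc.mem_of_tendsto (f.tendsto_leftLim r) ?_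
        filter_upwards [Ioo_mem_nhdsLT hi.1] with s hs
        exact ((hfine i).2 s ⟨hs.1.le, hs.2.le.trans hi.2⟩).2
    · rcases lt_or_ge r 0 with hr | hr
      · refine hzero hr.le ?_
        have hright : Function.rightLim f r = 0 :=
          rightLim_eq_of_tendsto (tendsto_const_nhds.congr' (by
            filter_upwards [mem_nhdsWithin_of_mem_nhds (Iio_mem_nhds hr)] with s hs
            exact (f.eq_zero_of_nonpos s (le_of_lt hs)).symm))
        rwa [hright, f.eq_zero_of_nonpos r hr.le, uIcc_self, mem_singleton_iff] at ha
      · obtain ⟨i, hi⟩ := exists_mem_Ico hlim (by rwa [hu0] : u 0 ≤ r)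
        have hi' := Ico_subset_Icc_self hi
        refine hmain i hi' (ordConnected_Icc.uIcc_subset ((hfine i).2 r hi').2 ?_ ha)
        refine isClosed_Icc.mem_of_tendsto (f.tendsto_rightLim r) ?_
        filter_upwards [Ioo_mem_nhdsGT hi.2] with s hs
        exact ((hfine i).2 s ⟨hi.1.trans hs.1.le, hs.2.le⟩).2

theorem exists_absolutelyContinuous_approx {Ω : Type*} [MeasurableSpace Ω] (P : Measure Ω)
    [IsProbabilityMeasure P] {ξ : Ω → ℝ} (hξ : Measurable ξ) (f : PathV) :
    ∃ F : ℕ → PathV, (∀ n, ∀ T : ℝ, 0 < T → AbsolutelyContinuousOnInterval (F n) 0 T) ∧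
      Tendsto (fun n => rho (F n) f) atTop (𝓝 0) ∧
      Tendsto (fun n => rate P ξ (F n)) atTop (𝓝 (rate P ξ f)) := by
  have hε : ∀ n : ℕ, (0 : ℝ) < 1 / ((n : ℝ) + 1) := fun n => Nat.one_div_pos_of_nat
  choose u hu hu0 hlim hfine using fun n => f.exists_fine_partition (hε n)
  let F : ℕ → PathV := fun n => interpV f (hu n) (hu0 n) (hlim n)
  have hrho : Tendsto (fun n => rho (F n) f) atTop (𝓝 0) := by
    refine tendsto_of_tendsto_of_tendsto_of_le_of_le tendsto_const_nhds ?_ (fun n => zero_le)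
      (fun n => rho_interpV_le f (hu n) (hu0 n) (hlim n) (hε n) (hfine n))
    have := (tendsto_one_div_add_atTop_nhds_zero_nat (𝕜 := ℝ)).const_mul 2
    simpa using ENNReal.tendsto_ofReal this
  have hF : Tendsto F atTop (𝓝 f) := by
    rw [tendsto_iff_edist_tendsto_0]
    exact hrho
  refine ⟨F, fun n T hT => absolutelyContinuousOnInterval_interp (hu n) (hu0 n) (hlim n) 0 T
    (by simp), hrho, tendsto_order.2 ⟨fun y hy => ?_, fun y hy => ?_⟩⟩
  -- Lower semicontinuity gives the bound from below; the bound from above holds for every `n`.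
  · exact hF.eventually (lowerSemicontinuous_rate P hξ f y hy)
  · refine Eventually.of_forall fun n => lt_of_le_of_lt ?_ hy
    rw [rate_eq_iSup_energy P hξ, rate_eq_iSup_energy P hξ]
    exact iSup_energy_interpV_le f (hu n) (hu0 n) (hlim n)

end HalfLineLDP

end

theorem lemma3p1 {Ω : Type*} [MeasurableSpace Ω] (P : Measure Ω) [IsProbabilityMeasure P]
    (ξ : Ω → ℝ) (hξ : Measurable ξ)
    (hnondeg : ¬ ∃ c : ℝ, ∀ᵐ ω ∂P, ξ ω = c)
    (hcramer : ∃ δ : ℝ, 0 < δ ∧ Integrable (fun ω => Real.exp (δ * |ξ ω|)) P)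
    (hmean : ∫ ω, ξ ω ∂P = 0) :
    LowerSemicontinuous (fun f : HalfLineLDP.PathV => HalfLineLDP.rate P ξ f) ∧
    (∃ C : ℝ, ∀ (f : HalfLineLDP.PathV) (N : ℝ), 0 ≤ N →
      HalfLineLDP.rate P ξ f ≤ ENNReal.ofReal N →
      ∀ U : ℝ, 1 ≤ U → |f U| ≤ C * √U * max N (√N)) ∧
    (∀ f : HalfLineLDP.PathV, ∃ F : ℕ → HalfLineLDP.PathV,
      (∀ n, ∀ T : ℝ, 0 < T → AbsolutelyContinuousOnInterval (F n) 0 T) ∧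
      Tendsto (fun n => HalfLineLDP.rho (F n) f) atTop (𝓝 0) ∧
      Tendsto (fun n => HalfLineLDP.rate P ξ (F n)) atTop (𝓝 (HalfLineLDP.rate P ξ f))) := by
  obtain ⟨δ, hδ, hint⟩ := hcramer
  exact ⟨HalfLineLDP.lowerSemicontinuous_rate P hξ,
    HalfLineLDP.exists_growth_bound P hξ hδ hint hmean,
    HalfLineLDP.exists_absolutelyContinuous_approx P hξ⟩
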